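/- Let $\mathbb F_q$ be a finite field with $q$ odd, let $p$ be its characteristic, and let $\mathrm{Tr}:\mathbb F_q\to\mathbb F_p$ be the absolute trace. For $f=\sum_{i\le N}a_iT^i\in\mathbb F_q((1/T))$ put $e(f)=\exp\big(\tfrac{2\pi i}{p}\mathrm{Tr}(a_{-1})\big)$. Let $F\in\mathbb F_q[T]$ be irreducible of degree $r$, and put $e_F(x)=e(x/F)$ and $G_F(s,t)=\sum_{\deg x<r}e_F(sx+tx^2)$ for $x,s,t\in\mathbb F_q[T]$. For $x$ coprime to $F$ let $\overline x$ be the unique polynomial with $\deg\overline x<r$ and $x\overline x\equiv1\pmod F$. Let $1\le m,n\le r$ be integers, let $s_0,t_0\in\mathbb F_q[T]$, and let $\mathcal I_m=\{s+s_0:\deg s<m\}$ and $\mathcal I_n=\{t+t_0:\deg t<n\}$. Let $E_F^{\mathrm{inv}}(\mathcal I_n)$ be the number of $(x_1,\dots,x_4)\in\mathcal I_n^4$, all $x_i$ coprime to $F$, with $\overline{x_1}+\overline{x_2}\equiv\overline{x_3}+\overline{x_4}\pmod F$, and let $E_F^{\mathrm{sq}}(\mathcal I_m)$ be the number of $(x_1,\dots,x_4)\in\mathcal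 I_m^4$ with $x_1^2+x_2^2\equiv x_3^2+x_4^2\pmod F$. Let $a\in\mathbb F_q[T]$ with $\gcd(a,F)=1$, and let $\alpha=(\alpha_s)_{s\in\mathcal I_m}$ and $\beta=(\beta_t)_{t\in\mathcal I_n}$ be complex weights, with $\|\alpha\|_2=\big(\sum_{s\in\mathcal I_m}|\alpha_s|^2\big)^{1/2}$ and $\|\beta\|_\infty=\max_{t\in\mathcal I_n}|\beta_t|$. Then $$\Big|\sum_{s\in\mathcal I_m}\ \sum_{\substack{t\in\mathcal I_n\\ t\not\equiv0\ (F)}}\alpha_s\beta_t\,G_F(s,at)\Big|\le\|\alpha\|_2\,\|\beta\|_\infty\,q^{5r/8+n/2}\,E_F^{\mathrm{inv}}(\mathcal I_n)^{1/8}\,E_F^{\mathrm{sq}}(\mathcal I_m)^{1/8}.$$ Moreover, $$E_F^{\mathrm{inv}}(\mathcal I_n)^{1/8}\le q^{o(r)}\big(q^{7n/16-r/16}+q^{n/4}\big),\qquad E_F^{\mathrm{sq}}(\mathcal I_m)^{1/8}\le q^{o(r)}\big(q^{m/2-r/8}+q^{m/4}\big),$$ where $o(r)$ stands for a function $\delta(r)$,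 depending only on $r$ and the fixed field $\mathbb F_q$ (not on $F,m,n,s_0,t_0$), with $\delta(r)/r\to0$ as $r\to\infty$. -/

import Mathlib

open Polynomial Filter Asymptotics
open scoped NNReal

namespace FFGauss

variable {K : Type*} [Field K]

section Character

/-- The ring embedding of `K[T]` into the field `K((1/T))` of Laurent series in `1/T`.
An element of `K((1/T))` is represented by a Laurent series in a variable `U = 1/T`, so that
`T` is sent to `U⁻¹` and the coefficient of `T ^ i` is the coefficient of `U ^ (-i)`. -/
noncomputable def toInfty : K[X] →+* LaurentSeries K :=
  Polynomial.eval₂RingHom (HahnSeries.C : K →+* LaurentSeries K) (HahnSeries.single (-1 : ℤ) 1)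

/-- The coefficient of `T ^ i` of an element of `K((1/T))`. -/
def coeffT (f : LaurentSeries K) (i : ℤ) : K := HahnSeries.coeff f (-i)

/-- The absolute trace from a finite field to its prime field. -/
noncomputable def absTrace (x : K) : ZMod (ringChar K) :=
  letI : Algebra (ZMod (ringChar K)) K := ZMod.algebra K (ringChar K)
  Algebra.trace (ZMod (ringChar K)) K x

/-- The additive character `e (∑ aᵢ Tⁱ) = exp (2πi Tr(a₋₁) / p)` of `K((1/T))`,
where `p` is the characteristic of the finite field `K`. -/
noncomputable def eInfty (f : LaurentSeries K) : ℂ :=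
  Complex.exp (2 * Real.pi * Complex.I * ((absTrace (coeffT f (-1))).val : ℂ) / (ringChar K : ℂ))

/-- The additive character `e_F(x) = e(x / F)` on `K[T]`. -/
noncomputable def eF (F x : K[X]) : ℂ := eInfty (toInfty x / toInfty F)

end Character

section Interval

variable [Finite K]

theorem finite_setOf_degree_sub_lt (x₀ : K[X]) (k : ℕ) :
    {x : K[X] | (x - x₀).degree < k}.Finite := by
  have h : (Polynomial.degreeLT K k : Set K[X]).Finite := by
    have : Finite (Polynomial.degreeLT K k) :=
      Finite.of_equiv _ (Polynomial.degreeLTEquiv K k).toEquiv.symm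
    exact Set.toFinite _
  refine (h.image (fun y => y + x₀)).subset ?_
  intro x hx
  exact ⟨x - x₀, Polynomial.mem_degreeLT.2 hx, sub_add_cancel x x₀⟩

/-- The interval `{x + x₀ : deg x < k}` of size `q ^ k` in `K[T]`. -/
noncomputable def interval (x₀ : K[X]) (k : ℕ) : Finset K[X] :=
  (finite_setOf_degree_sub_lt x₀ k).toFinset

theorem mem_interval {x₀ x : K[X]} {k : ℕ} : x ∈ interval x₀ k ↔ (x - x₀).degree < k := by
  simp [interval]

end Interval

section Inverse

theorem existsUnique_inverse {F x : K[X]} (hF : F ≠ 0) (hx : IsCoprime x F) :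
    ∃! y : K[X], y.degree < F.degree ∧ F ∣ x * y - 1 := by
  obtain ⟨u, v, huv⟩ := hx
  have key : F ∣ x * (u % F) - 1 := by
    refine ⟨-v - x * (u / F), ?_⟩
    have h := EuclideanDomain.div_add_mod u F
    linear_combination huv + x * h
  refine ⟨u % F, ⟨EuclideanDomain.mod_lt u hF, key⟩, ?_⟩
  rintro y ⟨hy, hxy⟩
  have h1 : F ∣ x * (y - u % F) := by
    have := dvd_sub hxy key
    convert this using 1
    ring
  have h2 : F ∣ y - u % F := (IsCoprime.symm ⟨u, v, huv⟩ : IsCoprime F x).dvd_of_dvd_mul_left h1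
  exact sub_eq_zero.1 (Polynomial.eq_zero_of_dvd_of_degree_lt h2
    (lt_of_le_of_lt (Polynomial.degree_sub_le _ _)
      (max_lt hy (EuclideanDomain.mod_lt u hF))))

open Classical in
/-- For `x` coprime to `F ≠ 0`, the unique polynomial `x̄` with `deg x̄ < deg F` and
`x * x̄ ≡ 1 mod F` (see `existsUnique_inverse`). -/
noncomputable def invMod (F x : K[X]) : K[X] :=
  if h : ∃ y : K[X], y.degree < F.degree ∧ F ∣ x * y - 1 then h.choose else 0

end Inverse

section Sums

variable [Finite K]

open Classical in
/-- The number of `(x₁, x₂, x₃, x₄) ∈ S⁴` (all coprime to `F`, so that the inverses exist) with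
`x̄₁ + x̄₂ ≡ x̄₃ + x̄₄ mod F`. -/
noncomputable def energyInv (F : K[X]) (S : Finset K[X]) : ℕ :=
  ((S ×ˢ S ×ˢ S ×ˢ S).filter fun x =>
    (IsCoprime x.1 F ∧ IsCoprime x.2.1 F ∧ IsCoprime x.2.2.1 F ∧ IsCoprime x.2.2.2 F) ∧
    F ∣ (invMod F x.1 + invMod F x.2.1) - (invMod F x.2.2.1 + invMod F x.2.2.2)).card

open Classical in
/-- The number of `(x₁, x₂, x₃, x₄) ∈ S⁴` with `x₁² + x₂² ≡ x₃² + x₄² mod F`. -/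
noncomputable def energySq (F : K[X]) (S : Finset K[X]) : ℕ :=
  ((S ×ˢ S ×ˢ S ×ˢ S).filter fun x =>
    F ∣ (x.1 ^ 2 + x.2.1 ^ 2) - (x.2.2.1 ^ 2 + x.2.2.2 ^ 2)).card

/-- The Gauss sum `G_F(s, t) = ∑_{deg x < deg F} e_F(s x + t x²)`. -/
noncomputable def gaussSumF (F s t : K[X]) : ℂ :=
  ∑ x ∈ interval (0 : K[X]) F.natDegree, eF F (s * x + t * x ^ 2)

open Classical in
/-- The bilinear form `∑_{s ∈ S} ∑_{t ∈ T, t ≢ 0 (F)} α_s β_t G_F(s, a t)`. -/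
noncomputable def gaussForm (F a : K[X]) (α β : K[X] → ℂ) (S T : Finset K[X]) : ℂ :=
  ∑ s ∈ S, ∑ t ∈ T with ¬ F ∣ t, α s * β t * gaussSumF F s (a * t)

/-- `‖α‖_σ = (∑_{s ∈ S} |α_s| ^ σ) ^ (1 / σ)`. -/
noncomputable def weightNorm (σ : ℝ) (S : Finset K[X]) (α : K[X] → ℂ) : ℝ :=
  (∑ s ∈ S, ‖α s‖ ^ σ) ^ (1 / σ)

/-- `‖α‖_∞ = max_{s ∈ S} |α_s|`. -/
noncomputable def weightSup (S : Finset K[X]) (α : K[X] → ℂ) : ℝ :=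
  ((S.sup fun s => ‖α s‖₊ : ℝ≥0) : ℝ)

end Sums

end FFGauss

/-! Let `L` be the residue field of `F`, with `|L| = q^r`, and `ψ` the character of `L` induced by
`e_F`. Completing the square, possible as `q` is odd, gives `G_F(s, at) = ψ(-s²/(4at)) G_F(0, at)`
with `|G_F(0, at)| = q^(r/2)`. Absorbing `G_F(0, at)` into `β_t` leaves a bilinear sum with phase
`ψ(s² · c/t)`. Cauchy–Schwarz over `s`, then over pairs `(t₁, t₂)`, removes the weights and leaves a
sum of `ψ` over products of differences; a last Cauchy–Schwarz with Parseval on `L` bounds it by the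
two energies (`norm_weighted_bilinear_le`).

Both energy bounds rest on the divisor bound `q^(o(r))` for degree at most `4r`. For squares, `x₁² -
x₃² ≡ x₄² - x₂²` factors into `ab ≡ cd`; given `c`, `d` and the quotient by `F`, the product `ab` is
a known polynomial (`card_productCongruence_le`). For inverses, fixing `x₃, x₄` puts `(x₁, x₂)` on a
modular hyperbola `(x + b)(y + b) = c`. Dirichlet's pigeonhole replaces `b` by a fraction `u/t` of
small degrees, so that `(tx + u)(ty + u)` takes few values as a polynomial (`card_hyperbola_le`). -/

namespace FFGauss

/-! ### The additive character `e_F` on the residue field of `F`. -/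

section QuotientCharacter

variable {K : Type*} [Field K]

theorem toInfty_monomial (n : ℕ) (c : K) :
    toInfty (monomial n c) = HahnSeries.single (-(n : ℤ)) c := by
  simp [toInfty, Polynomial.eval₂_monomial, HahnSeries.single_pow, HahnSeries.C_apply,
    HahnSeries.single_mul_single]

theorem coeff_toInfty_neg (x : K[X]) (n : ℕ) : (toInfty x).coeff (-(n : ℤ)) = x.coeff n := by
  induction x using Polynomial.induction_on' with
  | add p q hp hq => simp [hp, hq]
  | monomial k c =>
    rw [toInfty_monomial, HahnSeries.coeff_single, Polynomial.coeff_monomial]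
    by_cases h : k = n
    · simp [h]
    · rw [if_neg (by omega), if_neg h]

theorem coeff_toInfty_of_pos (x : K[X]) {i : ℤ} (hi : 0 < i) : (toInfty x).coeff i = 0 := by
  induction x using Polynomial.induction_on' with
  | add p q hp hq => simp [hp, hq]
  | monomial k c =>
    rw [toInfty_monomial, HahnSeries.coeff_single, if_neg (by omega)]

theorem toInfty_ne_zero {x : K[X]} (hx : x ≠ 0) : toInfty x ≠ 0 := by
  intro h
  apply hx
  ext n
  rw [← coeff_toInfty_neg, h]
  simp

theorem order_toInfty {x : K[X]} (hx : x ≠ 0) :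
    (toInfty x).order = -(x.natDegree : ℤ) := by
  apply le_antisymm
  · apply HahnSeries.order_le_of_coeff_ne_zero
    rw [coeff_toInfty_neg]
    exact leadingCoeff_ne_zero.2 hx
  · by_contra! h
    have h1 := mt HahnSeries.coeff_order_eq_zero.1 (toInfty_ne_zero hx)
    apply h1
    obtain ⟨n, hn⟩ : ∃ n : ℕ, (toInfty x).order = -(n : ℤ) :=
      ⟨(-(toInfty x).order).toNat, by omega⟩
    rw [hn, coeff_toInfty_neg]
    exact coeff_eq_zero_of_natDegree_lt (by omega)

theorem ringChar_ne_zero [Finite K] : ringChar K ≠ 0 :=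
  CharP.ringChar_ne_zero_of_finite K

theorem absTrace_add (x y : K) : absTrace (x + y) = absTrace x + absTrace y := by
  simp [absTrace]

theorem absTrace_zero : absTrace (0 : K) = 0 := by
  simp [absTrace]

theorem exists_absTrace_mul_ne_zero [Finite K] {a : K} (ha : a ≠ 0) :
    ∃ b : K, absTrace (a * b) ≠ 0 := by
  let : Algebra (ZMod (ringChar K)) K := ZMod.algebra K (ringChar K)
  exact FiniteField.trace_to_zmod_nondegenerate K ha

theorem eInfty_eq [Finite K] [NeZero (ringChar K)] (f : LaurentSeries K) :
    eInfty f = ZMod.stdAddChar (absTrace (coeffT f (-1))) := by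
  have h := ZMod.stdAddChar_coe (N := ringChar K) ((absTrace (coeffT f (-1))).val : ℤ)
  rw [Int.cast_natCast, ZMod.natCast_zmod_val] at h
  rw [h, eInfty, Int.cast_natCast]

theorem mk_invMod {F x : K[X]} [Fact (Irreducible F)] (hx : IsCoprime x F) :
    AdjoinRoot.mk F (invMod F x) = (AdjoinRoot.mk F x)⁻¹ := by
  have h := (existsUnique_inverse (Fact.out (p := Irreducible F)).ne_zero hx).exists
  rw [invMod, dif_pos h]
  have h2 := h.choose_spec.2
  rw [← AdjoinRoot.mk_eq_zero, map_sub, map_mul, map_one, sub_eq_zero] at h2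
  exact eq_inv_of_mul_eq_one_right h2

theorem isCoprime_iff_mk_ne_zero {F x : K[X]} (hF : Irreducible F) :
    IsCoprime x F ↔ AdjoinRoot.mk F x ≠ 0 := by
  rw [isCoprime_comm, hF.coprime_iff_not_dvd, Ne, AdjoinRoot.mk_eq_zero]

theorem mk_surjInv {F : K[X]} (z : AdjoinRoot F) :
    AdjoinRoot.mk F (Function.surjInv AdjoinRoot.mk_surjective z) = z :=
  Function.surjInv_eq AdjoinRoot.mk_surjective z

variable [Finite K]

theorem eInfty_add (f g : LaurentSeries K) : eInfty (f + g) = eInfty f * eInfty g := by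
  have : NeZero (ringChar K) := ⟨ringChar_ne_zero⟩
  simp only [eInfty_eq, coeffT, HahnSeries.coeff_add, absTrace_add, AddChar.map_add_eq_mul]

theorem eF_add (F x y : K[X]) : eF F (x + y) = eF F x * eF F y := by
  rw [eF, map_add, add_div, eInfty_add, eF, eF]

theorem eF_mul_self {F : K[X]} (hF : F ≠ 0) (x : K[X]) : eF F (F * x) = 1 := by
  have : NeZero (ringChar K) := ⟨ringChar_ne_zero⟩
  rw [eF, map_mul, mul_div_cancel_left₀ _ (toInfty_ne_zero hF), eInfty_eq, coeffT,
    coeff_toInfty_of_pos _ (by norm_num), absTrace_zero, AddChar.map_zero_eq_one]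

theorem eF_congr {F : K[X]} (hF : F ≠ 0) {x y : K[X]} (h : F ∣ x - y) : eF F x = eF F y := by
  obtain ⟨z, hz⟩ := h
  rw [← sub_add_cancel x y, hz, eF_add, eF_mul_self hF, one_mul]

/-- `T^(r-1)/F` has order exactly 1 in `1/T`, so its coefficient `a₋₁` is nonzero; nondegeneracy of
the trace supplies a scalar that makes the trace nonzero. -/
theorem exists_eF_ne_one {F : K[X]} (hF : 0 < F.natDegree) : ∃ x : K[X], eF F x ≠ 1 := by
  have : NeZero (ringChar K) := ⟨ringChar_ne_zero⟩
  have hF0 : F ≠ 0 := by rintro rfl; simp at hF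
  set g : LaurentSeries K := toInfty (X ^ (F.natDegree - 1)) / toInfty F with hg
  have hX : (X ^ (F.natDegree - 1) : K[X]) ≠ 0 := pow_ne_zero _ X_ne_zero
  have hg0 : g ≠ 0 := div_ne_zero (toInfty_ne_zero hX) (toInfty_ne_zero hF0)
  have hmul : g * toInfty F = toInfty (X ^ (F.natDegree - 1)) :=
    div_mul_cancel₀ _ (toInfty_ne_zero hF0)
  have hord : g.order = 1 := by
    have h := HahnSeries.order_mul hg0 (toInfty_ne_zero hF0)
    rw [hmul, order_toInfty hX, order_toInfty hF0, natDegree_X_pow] at h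
    omega
  have hc : g.coeff 1 ≠ 0 := by
    have h := mt HahnSeries.coeff_order_eq_zero.1 hg0
    rwa [hord] at h
  obtain ⟨b, hb⟩ := exists_absTrace_mul_ne_zero hc
  refine ⟨C b * X ^ (F.natDegree - 1), fun h => hb ?_⟩
  have hC : toInfty (C b) = HahnSeries.C b := by simp [toInfty]
  rw [eF, map_mul, mul_div_assoc, ← hg, eInfty_eq, hC, coeffT, HahnSeries.C_mul_eq_smul,
    HahnSeries.coeff_smul, smul_eq_mul, neg_neg, mul_comm] at h
  apply ZMod.injective_stdAddChar
  rw [h, AddChar.map_zero_eq_one]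

/-- The additive character of `K[T] / F` induced by `e_F`. -/
noncomputable def quotChar {F : K[X]} (hF : F ≠ 0) : AddChar (AdjoinRoot F) ℂ where
  toFun z := eF F (Function.surjInv AdjoinRoot.mk_surjective z)
  map_zero_eq_one' := by
    have h : F ∣ Function.surjInv (AdjoinRoot.mk_surjective (g := F)) 0 - F * 0 := by
      rw [← AdjoinRoot.mk_eq_zero, mul_zero, sub_zero, mk_surjInv]
    rw [eF_congr hF h, eF_mul_self hF]
  map_add_eq_mul' x y := by
    rw [← eF_add]
    apply eF_congr hF
    rw [← AdjoinRoot.mk_eq_zero]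
    simp_rw [map_sub, map_add, mk_surjInv, sub_self]

theorem quotChar_mk {F : K[X]} (hF : F ≠ 0) (x : K[X]) :
    quotChar hF (AdjoinRoot.mk F x) = eF F x := by
  apply eF_congr hF
  rw [← AdjoinRoot.mk_eq_zero, map_sub, mk_surjInv, sub_self]

theorem quotChar_isPrimitive {F : K[X]} [Fact (Irreducible F)] :
    (quotChar (Fact.out (p := Irreducible F)).ne_zero).IsPrimitive := by
  apply AddChar.IsPrimitive.of_ne_one
  intro h
  obtain ⟨x, hx⟩ := exists_eF_ne_one (Fact.out (p := Irreducible F)).natDegree_pos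
  apply hx
  rw [← quotChar_mk (Fact.out (p := Irreducible F)).ne_zero, h, AddChar.one_apply]

theorem card_interval (x₀ : K[X]) (k : ℕ) : (interval x₀ k).card = Nat.card K ^ k := by
  have e : interval x₀ k ≃ (Fin k → K) :=
    (Equiv.subtypeEquiv (Equiv.subRight x₀) fun x => by
      rw [mem_interval, Equiv.subRight_apply, Polynomial.mem_degreeLT]).trans
      (Polynomial.degreeLTEquiv K k).toEquiv
  rw [← Nat.card_eq_finsetCard, Nat.card_congr e, Nat.card_fun, Nat.card_fin]

theorem eq_of_dvd_sub {F x₀ x y : K[X]} {k : ℕ} (hk : k ≤ F.natDegree)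
    (hx : x ∈ interval x₀ k) (hy : y ∈ interval x₀ k) (h : F ∣ x - y) : x = y := by
  rw [mem_interval] at hx hy
  have hlt : (x - x₀ - (y - x₀)).degree < k :=
    lt_of_le_of_lt (degree_sub_le _ _) (max_lt hx hy)
  rw [sub_sub_sub_cancel_right] at hlt
  by_cases hF : F = 0
  · exact sub_eq_zero.1 (zero_dvd_iff.1 (hF ▸ h))
  · refine sub_eq_zero.1 (eq_zero_of_dvd_of_degree_lt h ?_)
    rw [degree_eq_natDegree hF]
    exact lt_of_lt_of_le hlt (by exact_mod_cast hk)

theorem mk_injOn_interval {F x₀ : K[X]} {k : ℕ} (hk : k ≤ F.natDegree) :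
    Set.InjOn (AdjoinRoot.mk F) (interval x₀ k) := by
  intro x hx y hy h
  exact eq_of_dvd_sub hk hx hy (AdjoinRoot.mk_eq_zero.1 (by rw [map_sub, h, sub_self]))

theorem exists_mem_interval_mk_eq {F : K[X]} (hF : F ≠ 0) (z : AdjoinRoot F) :
    ∃ x ∈ interval 0 F.natDegree, AdjoinRoot.mk F x = z := by
  obtain ⟨y, rfl⟩ := AdjoinRoot.mk_surjective z
  refine ⟨y % F, ?_, ?_⟩
  · rw [mem_interval, sub_zero, ← degree_eq_natDegree hF]
    exact EuclideanDomain.mod_lt y hF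
  · rw [eq_comm, ← sub_eq_zero, ← map_sub, AdjoinRoot.mk_eq_zero]
    exact ⟨y / F, by linear_combination -EuclideanDomain.div_add_mod y F⟩

theorem finite_adjoinRoot {F : K[X]} (hF : F ≠ 0) : Finite (AdjoinRoot F) :=
  Finite.of_surjective (fun x : interval (0 : K[X]) F.natDegree => AdjoinRoot.mk F x.1) fun z => by
    obtain ⟨x, hx, h⟩ := exists_mem_interval_mk_eq hF z
    exact ⟨⟨x, hx⟩, h⟩

theorem sum_interval_eq_sum_adjoinRoot {F : K[X]} (hF : F ≠ 0) [Fintype (AdjoinRoot F)]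
    {M : Type*} [AddCommMonoid M] (g : AdjoinRoot F → M) :
    ∑ x ∈ interval 0 F.natDegree, g (AdjoinRoot.mk F x) = ∑ z, g z := by
  refine Finset.sum_nbij (AdjoinRoot.mk F) (by simp) (mk_injOn_interval le_rfl) ?_ (by simp)
  intro z _
  obtain ⟨x, hx, h⟩ := exists_mem_interval_mk_eq hF z
  exact ⟨x, hx, h⟩

theorem card_adjoinRoot {F : K[X]} (hF : F ≠ 0) [Fintype (AdjoinRoot F)] :
    Fintype.card (AdjoinRoot F) = Nat.card K ^ F.natDegree := by
  have h := sum_interval_eq_sum_adjoinRoot hF (fun _ => (1 : ℕ))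
  simp only [Finset.sum_const, smul_eq_mul, mul_one, card_interval, Finset.card_univ] at h
  exact h.symm

end QuotientCharacter

/-! ### Bilinear character sums and quadratic Gauss sums over a finite field. -/

section Bilinear

variable {L : Type*}

theorem normSq_sum_eq {ι : Type*} (S : Finset ι) (c : ι → ℂ) :
    ((‖∑ i ∈ S, c i‖ ^ 2 : ℝ) : ℂ) = ∑ i ∈ S, ∑ j ∈ S, c i * (starRingEnd ℂ) (c j) := by
  rw [Complex.ofReal_pow, ← Complex.mul_conj', map_sum, Finset.sum_mul_sum]

open Classical in
/-- The number of coincidences `g i = g j` among pairs of elements of `S`. -/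
noncomputable def coincidences {ι : Type*} (S : Finset ι) (g : ι → L) : ℕ :=
  ((S ×ˢ S).filter fun x => g x.1 = g x.2).card

open Classical in
theorem sum_card_fiber_sq [Fintype L] {ι : Type*} (S : Finset ι) (f : ι → L) :
    ∑ u, (S.filter fun i => f i = u).card ^ 2 = coincidences S f := by
  rw [coincidences, Finset.card_eq_sum_card_fiberwise (f := fun x => f x.1) (t := Finset.univ)
    (by simp)]
  refine Finset.sum_congr rfl fun u _ => ?_
  rw [sq, ← Finset.card_product]
  congr 1
  ext ⟨i, j⟩
  simp only [Finset.mem_product, Finset.mem_filter]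
  constructor
  · rintro ⟨⟨h1, h2⟩, h3, h4⟩
    exact ⟨⟨⟨h1, h3⟩, h2.trans h4.symm⟩, h2⟩
  · rintro ⟨⟨⟨h1, h3⟩, h5⟩, h2⟩
    exact ⟨⟨h1, h2⟩, h3, h5 ▸ h2⟩

variable [Field L] [Fintype L]

-- Parseval: once the square is expanded, orthogonality in `u` keeps only the pairs with `g i = g
-- j`.
open Classical in
theorem sum_normSq_char_sum {ψ : AddChar L ℂ} (hψ : ψ.IsPrimitive) {ι : Type*} (S : Finset ι)
    (g : ι → L) :
    ∑ u, ‖∑ i ∈ S, ψ (u * g i)‖ ^ 2 = Fintype.card L * coincidences S g := by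
  have h : ((∑ u, ‖∑ i ∈ S, ψ (u * g i)‖ ^ 2 : ℝ) : ℂ) =
      ((Fintype.card L * coincidences S g : ℝ) : ℂ) := by
    rw [Complex.ofReal_sum]
    simp_rw [normSq_sum_eq, ← AddChar.map_neg_eq_conj, ← AddChar.map_add_eq_mul,
      ← sub_eq_add_neg, ← mul_sub]
    rw [Finset.sum_comm]
    simp_rw [Finset.sum_comm (s := Finset.univ), AddChar.sum_mulShift _ hψ, sub_eq_zero]
    rw [← Finset.sum_product' (f := fun i j => ((if g i = g j then Fintype.card L else 0 : ℕ) : ℂ)),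
      ← Nat.cast_sum, ← Finset.sum_filter, Finset.sum_const, coincidences]
    simp [mul_comm]
  exact_mod_cast h

/-- Group the `i` by the value `u = f i`, apply Cauchy–Schwarz over `u`, and use Parseval on the sum
over `Q`. -/
theorem normSq_bilinear_char_sum_le {ψ : AddChar L ℂ} (hψ : ψ.IsPrimitive) {ι κ : Type*}
    (P : Finset ι) (Q : Finset κ) (f : ι → L) (g : κ → L) :
    ‖∑ i ∈ P, ∑ j ∈ Q, ψ (f i * g j)‖ ^ 2 ≤
      Fintype.card L * coincidences P f * coincidences Q g := by
  classical
  have h1 : ∑ i ∈ P, ∑ j ∈ Q, ψ (f i * g j) =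
      ∑ u, ((P.filter fun i => f i = u).card : ℂ) * ∑ j ∈ Q, ψ (u * g j) := by
    rw [← Finset.sum_fiberwise P f]
    refine Finset.sum_congr rfl fun u _ => ?_
    rw [Finset.sum_congr rfl fun i hi => by rw [(Finset.mem_filter.1 hi).2], Finset.sum_const,
      nsmul_eq_mul]
  have h2 : ‖∑ i ∈ P, ∑ j ∈ Q, ψ (f i * g j)‖ ≤
      ∑ u, ((P.filter fun i => f i = u).card : ℝ) * ‖∑ j ∈ Q, ψ (u * g j)‖ := by
    rw [h1]
    refine (norm_sum_le _ _).trans (le_of_eq ?_)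
    simp
  calc ‖∑ i ∈ P, ∑ j ∈ Q, ψ (f i * g j)‖ ^ 2
      ≤ (∑ u, ((P.filter fun i => f i = u).card : ℝ) * ‖∑ j ∈ Q, ψ (u * g j)‖) ^ 2 := by gcongr
    _ ≤ (∑ u, ((P.filter fun i => f i = u).card : ℝ) ^ 2) *
          ∑ u, ‖∑ j ∈ Q, ψ (u * g j)‖ ^ 2 := Finset.sum_mul_sq_le_sq_mul_sq _ _ _
    _ = Fintype.card L * coincidences P f * coincidences Q g := by
      rw [sum_normSq_char_sum hψ, ← sum_card_fiber_sq P f]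
      push_cast
      ring

/-- The additive energy of the family `f` over `S`, in terms of differences. -/
noncomputable def diffEnergy {ι : Type*} (S : Finset ι) (f : ι → L) : ℕ :=
  coincidences (S ×ˢ S) fun x => f x.1 - f x.2

/-- The eighth power comes from three successive uses of Cauchy–Schwarz: over `s`, over pairs from
`T`, and over the field. -/
theorem norm_weighted_bilinear_le {ψ : AddChar L ℂ} (hψ : ψ.IsPrimitive) {ι κ : Type*}
    (S : Finset ι) (T : Finset κ) (f : ι → L) (g : κ → L) (α : ι → ℂ) (γ : κ → ℂ) {B : ℝ}
    (hB : 0 ≤ B) (hγ : ∀ t ∈ T, ‖γ t‖ ≤ B) :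
    ‖∑ s ∈ S, ∑ t ∈ T, α s * γ t * ψ (f s * g t)‖ ^ 8 ≤
      (∑ s ∈ S, ‖α s‖ ^ 2) ^ 4 * B ^ 8 * (T.card : ℝ) ^ 4 *
        (Fintype.card L * diffEnergy S f * diffEnergy T g) := by
  set W := ‖∑ s ∈ S, ∑ t ∈ T, α s * γ t * ψ (f s * g t)‖ with hW
  set Y := ∑ x ∈ T ×ˢ T, ‖∑ s ∈ S, ψ (f s * (g x.1 - g x.2))‖ with hY
  set Z := ∑ x ∈ T ×ˢ T, ‖∑ s ∈ S, ψ (f s * (g x.1 - g x.2))‖ ^ 2 with hZ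
  have hY0 : 0 ≤ Y := Finset.sum_nonneg fun _ _ => norm_nonneg _
  have hZ0 : 0 ≤ Z := Finset.sum_nonneg fun _ _ => by positivity
  have h1 : W ^ 2 ≤ (∑ s ∈ S, ‖α s‖ ^ 2) * ∑ s ∈ S, ‖∑ t ∈ T, γ t * ψ (f s * g t)‖ ^ 2 := by
    refine le_trans ?_ (Finset.sum_mul_sq_le_sq_mul_sq _ _ _)
    rw [hW]
    gcongr
    refine (norm_sum_le _ _).trans (Finset.sum_le_sum fun s _ => ?_)
    rw [← norm_mul, Finset.mul_sum]
    simp_rw [mul_assoc]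
    exact le_rfl
  -- Expanding the square and summing over `s` inside leaves unweighted sums over `S`, at
  -- frequencies `g t₁ - g t₂`.
  have h2 : ∑ s ∈ S, ‖∑ t ∈ T, γ t * ψ (f s * g t)‖ ^ 2 ≤ B ^ 2 * Y := by
    have h : ((∑ s ∈ S, ‖∑ t ∈ T, γ t * ψ (f s * g t)‖ ^ 2 : ℝ) : ℂ) =
        ∑ x ∈ T ×ˢ T, γ x.1 * (starRingEnd ℂ) (γ x.2) *
          ∑ s ∈ S, ψ (f s * (g x.1 - g x.2)) := by
      rw [Complex.ofReal_sum]
      simp_rw [normSq_sum_eq, Finset.mul_sum]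
      rw [Finset.sum_comm' (t' := S) (s' := fun _ => T ×ˢ T) (by tauto)]
      refine Finset.sum_congr rfl fun s _ => ?_
      rw [← Finset.sum_product']
      refine Finset.sum_congr rfl fun x _ => ?_
      rw [mul_sub, sub_eq_add_neg, AddChar.map_add_eq_mul, AddChar.map_neg_eq_conj,
        map_mul (starRingEnd ℂ)]
      ring
    calc ∑ s ∈ S, ‖∑ t ∈ T, γ t * ψ (f s * g t)‖ ^ 2
        = ‖((∑ s ∈ S, ‖∑ t ∈ T, γ t * ψ (f s * g t)‖ ^ 2 : ℝ) : ℂ)‖ := by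
          rw [Complex.norm_real, Real.norm_of_nonneg]
          exact Finset.sum_nonneg fun _ _ => by positivity
      _ ≤ ∑ x ∈ T ×ˢ T, B ^ 2 * ‖∑ s ∈ S, ψ (f s * (g x.1 - g x.2))‖ := by
          rw [h]
          refine (norm_sum_le _ _).trans (Finset.sum_le_sum fun x hx => ?_)
          rw [Finset.mem_product] at hx
          rw [norm_mul, norm_mul, RCLike.norm_conj, sq]
          gcongr
          · exact hγ _ hx.1
          · exact hγ _ hx.2
      _ = B ^ 2 * Y := by rw [Finset.mul_sum]
  have h3 : Y ^ 2 ≤ (T.card : ℝ) ^ 2 * Z := by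
    have h := sq_sum_le_card_mul_sum_sq (s := T ×ˢ T)
      (f := fun x => ‖∑ s ∈ S, ψ (f s * (g x.1 - g x.2))‖)
    rw [Finset.card_product, Nat.cast_mul, ← sq] at h
    exact h
  -- `Z` is itself an unweighted bilinear sum over differences from `S` and differences from `T`.
  have h4 : Z ^ 2 ≤ Fintype.card L * diffEnergy S f * diffEnergy T g := by
    have h : (Z : ℂ) = ∑ y ∈ S ×ˢ S, ∑ x ∈ T ×ˢ T,
        ψ ((f y.1 - f y.2) * (g x.1 - g x.2)) := by
      rw [hZ, Complex.ofReal_sum, Finset.sum_comm]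
      refine Finset.sum_congr rfl fun x _ => ?_
      rw [normSq_sum_eq, ← Finset.sum_product']
      refine Finset.sum_congr rfl fun y _ => ?_
      rw [sub_mul, sub_eq_add_neg (f y.1 * _), AddChar.map_add_eq_mul, AddChar.map_neg_eq_conj]
    have h' := normSq_bilinear_char_sum_le hψ (S ×ˢ S) (T ×ˢ T) (fun y => f y.1 - f y.2)
      (fun x => g x.1 - g x.2)
    rw [← h, Complex.norm_real, Real.norm_of_nonneg hZ0] at h'
    exact h'
  have hA : 0 ≤ ∑ s ∈ S, ‖α s‖ ^ 2 := Finset.sum_nonneg fun _ _ => by positivity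
  calc W ^ 8 = (W ^ 2) ^ 4 := by ring
    _ ≤ ((∑ s ∈ S, ‖α s‖ ^ 2) * (B ^ 2 * Y)) ^ 4 := by
        gcongr
        exact h1.trans (by gcongr)
    _ = (∑ s ∈ S, ‖α s‖ ^ 2) ^ 4 * B ^ 8 * (Y ^ 2) ^ 2 := by ring
    _ ≤ (∑ s ∈ S, ‖α s‖ ^ 2) ^ 4 * B ^ 8 * ((T.card : ℝ) ^ 2 * Z) ^ 2 := by gcongr
    _ = (∑ s ∈ S, ‖α s‖ ^ 2) ^ 4 * B ^ 8 * (T.card : ℝ) ^ 4 * Z ^ 2 := by ring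
    _ ≤ _ := by gcongr

theorem gauss_sum_complete_square {ψ : AddChar L ℂ} (h2 : (2 : L) ≠ 0) {A : L} (hA : A ≠ 0)
    (s : L) :
    ∑ x, ψ (s * x + A * x ^ 2) = ψ (s ^ 2 * -(4 * A)⁻¹) * ∑ x, ψ (A * x ^ 2) := by
  rw [Finset.mul_sum]
  refine Fintype.sum_equiv (Equiv.addRight (s / (2 * A))) _ _ fun x => ?_
  rw [← AddChar.map_add_eq_mul, Equiv.coe_addRight]
  congr 1
  have h4 : (4 : L) ≠ 0 := by
    rw [show (4 : L) = 2 * 2 by norm_num]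
    exact mul_ne_zero h2 h2
  field_simp
  ring

/-- With `x = y + h` the phase becomes linear in `y`, so the sum over `y` vanishes unless `2Ah = 0`,
that is `h = 0`. -/
theorem normSq_gauss_sum {ψ : AddChar L ℂ} (hψ : ψ.IsPrimitive) (h2 : (2 : L) ≠ 0) {A : L}
    (hA : A ≠ 0) : ‖∑ x, ψ (A * x ^ 2)‖ ^ 2 = Fintype.card L := by
  classical
  have h : ((‖∑ x, ψ (A * x ^ 2)‖ ^ 2 : ℝ) : ℂ) = ((Fintype.card L : ℝ) : ℂ) := by
    rw [normSq_sum_eq]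
    have h1 : ∀ y : L, ∑ x, ψ (A * x ^ 2) * (starRingEnd ℂ) (ψ (A * y ^ 2)) =
        ∑ h, ψ (A * h ^ 2) * ψ (y * (2 * A * h)) := by
      intro y
      refine Fintype.sum_equiv (Equiv.subRight y) _ _ fun x => ?_
      rw [← AddChar.map_neg_eq_conj, ← AddChar.map_add_eq_mul, ← AddChar.map_add_eq_mul,
        Equiv.subRight_apply]
      congr 1
      ring
    rw [Finset.sum_comm]
    simp_rw [h1]
    rw [Finset.sum_comm]
    simp_rw [← Finset.mul_sum, AddChar.sum_mulShift _ hψ]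
    rw [Finset.sum_eq_single 0]
    · simp
    · intro b _ hb
      rw [if_neg (mul_ne_zero (mul_ne_zero h2 hA) hb)]
      simp
    · simp
  exact_mod_cast h

end Bilinear

/-! ### A subexponential bound for the number of divisors. -/

section Divisors

variable {K : Type*} [Field K]

open UniqueFactorizationMonoid Classical in
/-- The leading coefficient of a polynomial with its irreducible factors, grouped into those of
degree less than `k` and the rest. -/
noncomputable def splitFactors (k : ℕ) (d : K[X]) : K × Multiset K[X] × Multiset K[X] :=
  (d.leadingCoeff, (normalizedFactors d).filter (fun p => p.natDegree < k),
    (normalizedFactors d).filter (fun p => ¬ p.natDegree < k))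

open UniqueFactorizationMonoid Classical in
theorem eq_leadingCoeff_mul_prod_normalizedFactors {d : K[X]} (hd : d ≠ 0) :
    d = C d.leadingCoeff * (normalizedFactors d).prod := by
  rw [prod_normalizedFactors_eq hd, normalize_apply, coe_normUnit,
    CommGroupWithZero.coe_normUnit _ (leadingCoeff_ne_zero.2 hd), mul_left_comm, ← C_mul,
    mul_inv_cancel₀ (leadingCoeff_ne_zero.2 hd), C_1, mul_one]

theorem splitFactors_injOn (k : ℕ) : Set.InjOn (splitFactors (K := K) k) {d | d ≠ 0} := by
  classical
  intro d hd e he h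
  simp only [splitFactors, Prod.mk.injEq] at h
  rw [eq_leadingCoeff_mul_prod_normalizedFactors hd,
    eq_leadingCoeff_mul_prod_normalizedFactors he, h.1,
    ← Multiset.filter_add_not (fun p : K[X] => p.natDegree < k)
      (UniqueFactorizationMonoid.normalizedFactors d), h.2.1, h.2.2, Multiset.filter_add_not]

theorem card_Iic_le_two_pow {α : Type*} [DecidableEq α] (s : Multiset α) :
    (Finset.Iic s).card ≤ 2 ^ s.card := by
  rw [Multiset.card_Iic, ← Multiset.toFinset_sum_count_eq, ← Finset.prod_pow_eq_pow_sum]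
  exact Finset.prod_le_prod' fun i _ => Nat.lt_two_pow_self

open UniqueFactorizationMonoid Classical in
theorem natDegree_eq_sum_normalizedFactors {N : K[X]} (hN : N ≠ 0) :
    N.natDegree = ((normalizedFactors N).map natDegree).sum := by
  conv_lhs => rw [eq_leadingCoeff_mul_prod_normalizedFactors hN]
  rw [natDegree_C_mul (leadingCoeff_ne_zero.2 hN), natDegree_multiset_prod]
  exact zero_notMem_normalizedFactors N

theorem card_mul_le_sum_map {α : Type*} (s : Multiset α) (f : α → ℕ) (k : ℕ)
    (h : ∀ a ∈ s, k ≤ f a) : s.card * k ≤ (s.map f).sum := by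
  have := Multiset.card_nsmul_le_sum (s := s.map f) (a := k) (by simpa using h)
  simpa using this

variable [Finite K]

open UniqueFactorizationMonoid Classical in
theorem card_divisors_le_card_Iic_mul (k : ℕ) {N : K[X]} (hN : N ≠ 0) (A : Finset K[X]) (hA : ∀ d ∈ A, d ∣ N) :
    A.card ≤ Nat.card K *
      ((Finset.Iic ((normalizedFactors N).filter (fun p => p.natDegree < k))).card *
      (Finset.Iic ((normalizedFactors N).filter (fun p => ¬ p.natDegree < k))).card) := by
  have := Fintype.ofFinite K
  rw [Nat.card_eq_fintype_card, ← Finset.card_univ, ← Finset.card_product, ← Finset.card_product]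
  have h0 : ∀ d ∈ A, d ≠ 0 := by
    rintro d hd rfl
    exact hN (zero_dvd_iff.1 (hA 0 hd))
  refine Finset.card_le_card_of_injOn (splitFactors k) ?_
    ((splitFactors_injOn k).mono fun d hd => h0 d hd)
  intro d hd
  have hle := (dvd_iff_normalizedFactors_le_normalizedFactors (h0 d hd) hN).1 (hA d hd)
  simp only [splitFactors, Finset.coe_product, Set.mem_prod, Finset.mem_coe, Finset.mem_univ,
    Finset.mem_Iic, true_and]
  exact ⟨Multiset.filter_le_filter _ hle, Multiset.filter_le_filter _ hle⟩

-- There are at most `q^k` normalized irreducibles of degree below `k`, each with multiplicity at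
-- most `D`; at most `D / k` factors have larger degree, giving at most `2^(D/k)` submultisets. The
-- factor `q` counts leading coefficients.
open UniqueFactorizationMonoid Classical in
theorem card_divisors_le {k : ℕ} (hk : 0 < k) {N : K[X]} (hN : N ≠ 0) {D : ℕ}
    (hD : N.natDegree ≤ D) (A : Finset K[X]) (hA : ∀ d ∈ A, d ∣ N) :
    A.card ≤ Nat.card K * ((D + 1) ^ (Nat.card K ^ k) * 2 ^ (D / k)) := by
  refine (card_divisors_le_card_Iic_mul k hN A hA).trans ?_
  have hdeg := natDegree_eq_sum_normalizedFactors hN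
  have hpos : ∀ p ∈ normalizedFactors N, 1 ≤ p.natDegree := fun p hp =>
    (irreducible_of_normalized_factor p hp).natDegree_pos
  have hcard : (normalizedFactors N).card ≤ D := by
    have := card_mul_le_sum_map _ natDegree 1 hpos
    omega
  gcongr
  · rw [Multiset.card_Iic]
    calc ∏ i ∈ ((normalizedFactors N).filter (fun p => p.natDegree < k)).toFinset,
          (Multiset.count i ((normalizedFactors N).filter (fun p => p.natDegree < k)) + 1)
        ≤ ∏ i ∈ ((normalizedFactors N).filter (fun p => p.natDegree < k)).toFinset, (D + 1) := by
          refine Finset.prod_le_prod' fun i _ => ?_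
          have h1 := Multiset.count_le_card i
            ((normalizedFactors N).filter (fun p => p.natDegree < k))
          have h2 := Multiset.card_le_card
            (Multiset.filter_le (fun p : K[X] => p.natDegree < k) (normalizedFactors N))
          omega
      _ ≤ (D + 1) ^ (Nat.card K ^ k) := by
          rw [Finset.prod_const]
          refine Nat.pow_le_pow_right (by omega) ?_
          rw [← card_interval (0 : K[X]) k]
          refine Finset.card_le_card fun p hp => ?_
          rw [Multiset.mem_toFinset, Multiset.mem_filter] at hp
          rw [mem_interval, sub_zero]
          exact degree_le_natDegree.trans_lt (by exact_mod_cast hp.2)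
  · refine (card_Iic_le_two_pow _).trans (Nat.pow_le_pow_right (by norm_num) ?_)
    rw [Nat.le_div_iff_mul_le hk]
    refine (card_mul_le_sum_map _ natDegree k fun a ha => ?_).trans ?_
    · exact not_lt.1 (Multiset.mem_filter.1 ha).2
    · refine le_trans ?_ (hdeg.symm.le.trans hD)
      conv_rhs => rw [← Multiset.filter_add_not (fun p : K[X] => p.natDegree < k)
        (normalizedFactors N)]
      rw [Multiset.map_add, Multiset.sum_add]
      omega

variable (K) in
/-- An upper bound for the number of divisors of a nonzero polynomial of degree at most `4 r`. -/
noncomputable def maxDivisors (r : ℕ) : ℕ :=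
  sSup {c | ∃ N : K[X], N ≠ 0 ∧ N.natDegree ≤ 4 * r ∧ ∃ A : Finset K[X],
    (∀ d ∈ A, d ∣ N) ∧ A.card = c}

/-- Needed because `sSup` of an unbounded set of naturals is 0. -/
theorem bddAbove_divisors (r : ℕ) : BddAbove {c | ∃ N : K[X], N ≠ 0 ∧ N.natDegree ≤ 4 * r ∧
    ∃ A : Finset K[X], (∀ d ∈ A, d ∣ N) ∧ A.card = c} := by
  refine ⟨Nat.card K * ((4 * r + 1) ^ (Nat.card K ^ 1) * 2 ^ (4 * r / 1)), ?_⟩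
  rintro c ⟨N, hN, hr, A, hA, rfl⟩
  exact card_divisors_le one_pos hN hr A hA

theorem card_le_maxDivisors {r : ℕ} {N : K[X]} (hN : N ≠ 0) (hr : N.natDegree ≤ 4 * r)
    (A : Finset K[X]) (hA : ∀ d ∈ A, d ∣ N) : A.card ≤ maxDivisors K r :=
  le_csSup (bddAbove_divisors r) ⟨N, hN, hr, A, hA, rfl⟩

theorem card_le_maxDivisors_of_injOn {ι : Type*} {r : ℕ} {N : K[X]} (hN : N ≠ 0)
    (hr : N.natDegree ≤ 4 * r) (S : Finset ι) (f : ι → K[X]) (hf : Set.InjOn f S)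
    (hdvd : ∀ i ∈ S, f i ∣ N) : S.card ≤ maxDivisors K r := by
  classical
  rw [← Finset.card_image_of_injOn hf]
  exact card_le_maxDivisors hN hr _ (by simpa using hdvd)

theorem one_le_maxDivisors (r : ℕ) : 1 ≤ maxDivisors K r :=
  card_le_maxDivisors (N := (1 : K[X])) one_ne_zero (by simp) {1} (by simp)

theorem maxDivisors_le {k : ℕ} (hk : 0 < k) (r : ℕ) :
    maxDivisors K r ≤ Nat.card K * ((4 * r + 1) ^ (Nat.card K ^ k) * 2 ^ (4 * r / k)) := by
  refine csSup_le ⟨1, 1, one_ne_zero, by simp, {1}, by simp, by simp⟩ ?_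
  rintro c ⟨N, hN, hr, A, hA, rfl⟩
  exact card_divisors_le hk hN hr A hA

theorem isLittleO_log_four_mul_add_one :
    (fun r : ℕ => Real.log (4 * r + 1)) =o[atTop] fun r : ℕ => (r : ℝ) := by
  have h : Tendsto (fun r : ℕ => (4 * r + 1 : ℝ)) atTop atTop :=
    tendsto_atTop_add_const_right _ _
      (tendsto_natCast_atTop_atTop.const_mul_atTop (by norm_num))
  refine (Real.isLittleO_log_id_atTop.comp_tendsto h).trans_isBigO ?_
  refine IsBigO.of_bound 5 ?_
  filter_upwards [eventually_ge_atTop 1] with r hr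
  have hr' : (1 : ℝ) ≤ r := by exact_mod_cast hr
  simp only [Function.comp_apply, id]
  rw [Real.norm_of_nonneg (by positivity), Real.norm_of_nonneg (by positivity)]
  linarith

theorem isLittleO_log_maxDivisors {c : ℝ} (hc : 1 ≤ c) :
    (fun r : ℕ => Real.log (c * maxDivisors K r)) =o[atTop] fun r : ℕ => (r : ℝ) := by
  rw [isLittleO_iff]
  intro ε hε
  -- With this `k` the factor `2^(4r/k)` costs at most `ε r / 2`; for fixed `k` the rest is `O(log
  -- r)`.
  obtain ⟨k, hk⟩ := exists_nat_gt (8 / ε)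
  have hk0 : (0 : ℝ) < k := lt_trans (by positivity) hk
  have hq : (0 : ℝ) < Nat.card K := by exact_mod_cast Nat.card_pos
  have hlo : (fun r : ℕ => Real.log (c * Nat.card K) +
      ((Nat.card K ^ k : ℕ) : ℝ) * Real.log (4 * r + 1)) =o[atTop] fun r : ℕ => (r : ℝ) := by
    refine IsLittleO.add ?_ (isLittleO_log_four_mul_add_one.const_mul_left _)
    exact isLittleO_const_left.2 (Or.inr (tendsto_norm_atTop_atTop.comp
      tendsto_natCast_atTop_atTop))
  have h2 := (isLittleO_iff.1 hlo) (half_pos hε)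
  filter_upwards [h2] with r hr
  have hM : (1 : ℝ) ≤ maxDivisors K r := by exact_mod_cast one_le_maxDivisors r
  have hle : (maxDivisors K r : ℝ) ≤
      Nat.card K * ((4 * r + 1) ^ (Nat.card K ^ k) * 2 ^ (4 * r / k)) := by
    exact_mod_cast maxDivisors_le (by exact_mod_cast hk0) r
  have hdiv : ((4 * r / k : ℕ) : ℝ) ≤ ε / 2 * r := by
    refine Nat.cast_div_le.trans ?_
    rw [div_le_iff₀ hk0]
    rw [div_lt_iff₀ hε] at hk
    push_cast
    nlinarith [(Nat.cast_nonneg r : (0 : ℝ) ≤ r)]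
  rw [Real.norm_of_nonneg (Real.log_nonneg (by nlinarith)), Real.norm_of_nonneg (by positivity)]
  rw [Real.norm_of_nonneg (Nat.cast_nonneg r)] at hr
  calc Real.log (c * maxDivisors K r)
      ≤ Real.log (c * (Nat.card K * ((4 * r + 1) ^ (Nat.card K ^ k) * 2 ^ (4 * r / k)))) := by
        gcongr
    _ = Real.log (c * Nat.card K) + ((Nat.card K ^ k : ℕ) : ℝ) * Real.log (4 * r + 1) +
          ((4 * r / k : ℕ) : ℝ) * Real.log 2 := by
        rw [← mul_assoc, Real.log_mul (by positivity) (by positivity),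
          Real.log_mul (x := (4 * r + 1 : ℝ) ^ _) (by positivity) (by positivity), Real.log_pow,
          Real.log_pow, add_assoc]
    _ ≤ ε / 2 * r + ε / 2 * r * 1 := by
        gcongr
        · exact (Real.le_norm_self _).trans hr
        · linarith [Real.log_two_lt_d9]
    _ = ε * r := by ring

end Divisors

/-! ### Bounds for the two additive energies. -/

section Energies

variable {K : Type*} [Field K]

open Classical in
/-- The quadruples `(d, y, d', y') ∈ I × J × I × J` with `d y ≡ d' y' mod F`. -/
noncomputable def productCongruence (F : K[X]) (I J : Finset K[X]) :
    Finset (K[X] × K[X] × K[X] × K[X]) :=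
  (I ×ˢ J ×ˢ I ×ˢ J).filter fun x => F ∣ x.1 * x.2.1 - x.2.2.1 * x.2.2.2

theorem mem_productCongruence {F : K[X]} {I J : Finset K[X]} {x : K[X] × K[X] × K[X] × K[X]} :
    x ∈ productCongruence F I J ↔ (x.1 ∈ I ∧ x.2.1 ∈ J ∧ x.2.2.1 ∈ I ∧ x.2.2.2 ∈ J) ∧
      F ∣ x.1 * x.2.1 - x.2.2.1 * x.2.2.2 := by
  simp [productCongruence]

theorem natDegree_mul_sub_mul_le {a b c d : K[X]} {i j : ℕ} (ha : a.natDegree ≤ i)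
    (hb : b.natDegree ≤ j) (hc : c.natDegree ≤ i) (hd : d.natDegree ≤ j) :
    (a * b - c * d).natDegree ≤ i + j :=
  (natDegree_sub_le _ _).trans
    (max_le (natDegree_mul_le_of_le ha hb) (natDegree_mul_le_of_le hc hd))

theorem natDegree_add_sub_add_le {a b c d : K[X]} {i : ℕ} (ha : a.natDegree ≤ i)
    (hb : b.natDegree ≤ i) (hc : c.natDegree ≤ i) (hd : d.natDegree ≤ i) :
    (a + b - (c + d)).natDegree ≤ i :=
  (natDegree_sub_le _ _).trans
    (max_le (natDegree_add_le_of_degree_le ha hb) (natDegree_add_le_of_degree_le hc hd))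

variable [Finite K]

theorem mem_interval_zero {x : K[X]} {k : ℕ} (hk : 0 < k) :
    x ∈ interval 0 k ↔ x.natDegree < k := by
  rw [mem_interval, sub_zero]
  rcases eq_or_ne x 0 with rfl | hx
  · simpa [WithBot.bot_lt_coe] using hk
  · exact (natDegree_lt_iff_degree_lt hx).symm

theorem mem_interval_of_natDegree_mul {F z : K[X]} {h : ℕ} (hF : F ≠ 0)
    (hz : (F * z).natDegree < F.natDegree + h) : z ∈ interval 0 h := by
  rcases eq_or_ne z 0 with rfl | hz0
  · rw [mem_interval, sub_zero, degree_zero]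
    exact WithBot.bot_lt_coe h
  · rw [natDegree_mul hF hz0] at hz
    exact (mem_interval_zero (by omega)).2 (by omega)

theorem zero_mem_interval_zero (k : ℕ) : (0 : K[X]) ∈ interval 0 k := by
  rw [mem_interval, sub_zero, degree_zero]
  exact WithBot.bot_lt_coe k

theorem eq_zero_of_mem_interval_of_dvd {F x : K[X]} {k : ℕ} (hk : k ≤ F.natDegree)
    (hx : x ∈ interval 0 k) (h : F ∣ x) : x = 0 :=
  eq_of_dvd_sub hk hx (zero_mem_interval_zero k) (by rwa [sub_zero])

theorem sub_mem_interval_zero {x₀ x y : K[X]} {k : ℕ} (hx : x ∈ interval x₀ k)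
    (hy : y ∈ interval x₀ k) : x - y ∈ interval 0 k := by
  rw [mem_interval] at *
  rw [sub_zero, ← sub_sub_sub_cancel_right x y x₀]
  exact (degree_sub_le _ _).trans_lt (max_lt hx hy)

theorem add_mem_interval_two_mul {x₀ x y : K[X]} {k : ℕ} (hx : x ∈ interval x₀ k)
    (hy : y ∈ interval x₀ k) : x + y ∈ interval (2 * x₀) k := by
  rw [mem_interval] at *
  rw [show x + y - 2 * x₀ = (x - x₀) + (y - x₀) by ring]
  exact (degree_add_le _ _).trans_lt (max_lt hx hy)

/-- For fixed `(d, d')` the congruence is linear in `(y, y')`, so subtracting one solution maps the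
others into the centred interval. -/
theorem card_productCongruence_translate_le (F y₀ : K[X]) (I : Finset K[X]) (m : ℕ) :
    (productCongruence F I (interval y₀ m)).card ≤
      (productCongruence F I (interval 0 m)).card := by
  classical
  rw [Finset.card_eq_sum_card_fiberwise (f := fun x => (x.1, x.2.2.1)) (t := I ×ˢ I)
      (fun x hx => by
        have := (mem_productCongruence.1 hx).1
        exact Finset.mem_product.2 ⟨this.1, this.2.2.1⟩),
    Finset.card_eq_sum_card_fiberwise (s := productCongruence F I (interval 0 m))
      (f := fun x => (x.1, x.2.2.1)) (t := I ×ˢ I)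
      (fun x hx => by
        have := (mem_productCongruence.1 hx).1
        exact Finset.mem_product.2 ⟨this.1, this.2.2.1⟩)]
  refine Finset.sum_le_sum fun p _ => ?_
  obtain ⟨d, d'⟩ := p
  rcases Finset.eq_empty_or_nonempty ((productCongruence F I (interval y₀ m)).filter
    fun x => (x.1, x.2.2.1) = (d, d')) with h | ⟨⟨_, y, _, y'⟩, hy⟩
  · rw [h]
    simp
  · simp only [Finset.mem_filter, mem_productCongruence, Prod.mk.injEq] at hy
    obtain ⟨⟨⟨-, hy, -, hy'⟩, hdvd⟩, rfl, rfl⟩ := hy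
    refine Finset.card_le_card_of_injOn (fun x => (x.1, x.2.1 - y, x.2.2.1, x.2.2.2 - y')) ?_ ?_
    · rintro ⟨e, z, e', z'⟩ hz
      simp only [Finset.coe_filter, Set.mem_ofPred_eq, mem_productCongruence, Prod.mk.injEq]
        at hz ⊢
      obtain ⟨⟨⟨h1, hz, h2, hz'⟩, hzdvd⟩, rfl, rfl⟩ := hz
      refine ⟨⟨⟨h1, sub_mem_interval_zero hz hy, h2, sub_mem_interval_zero hz' hy'⟩, ?_⟩, rfl, rfl⟩
      convert dvd_sub hzdvd hdvd using 1
      ring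
    · rintro ⟨e, z, e', z'⟩ - ⟨f, w, f', w'⟩ - h
      simpa using h

/-- Difference of squares: `(x₁ - x₃)(x₁ + x₃) ≡ (x₄ - x₂)(x₄ + x₂)`. The change of variables is
injective as 2 is invertible; the sums lie around `2 s₀`, a shift that the previous lemma removes.
-/
theorem energySq_le_productCongruence (h2 : (2 : K[X]) ≠ 0) (F s₀ : K[X]) (m : ℕ) :
    energySq F (interval s₀ m) ≤ (productCongruence F (interval 0 m) (interval 0 m)).card := by
  refine le_trans ?_ (card_productCongruence_translate_le F (2 * s₀) _ m)
  rw [energySq]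
  refine Finset.card_le_card_of_injOn
    (fun x => (x.1 - x.2.2.1, x.1 + x.2.2.1, x.2.2.2 - x.2.1, x.2.2.2 + x.2.1)) ?_ ?_
  · rintro ⟨a, b, c, d⟩ hx
    simp only [Finset.coe_filter, Set.mem_ofPred_eq, Finset.mem_product] at hx
    obtain ⟨⟨ha, hb, hc, hd⟩, hdvd⟩ := hx
    refine mem_productCongruence.2 ⟨⟨sub_mem_interval_zero ha hc, add_mem_interval_two_mul ha hc,
      sub_mem_interval_zero hd hb, add_mem_interval_two_mul hd hb⟩, ?_⟩
    convert hdvd using 1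
    ring
  · rintro ⟨a, b, c, d⟩ - ⟨a', b', c', d'⟩ - h
    simp only [Prod.mk.injEq] at h
    obtain ⟨e1, e2, e3, e4⟩ := h
    have ha : a = a' := mul_left_cancel₀ h2 (by linear_combination e1 + e2)
    have hc : c = c' := mul_left_cancel₀ h2 (by linear_combination e2 - e1)
    have hb : b = b' := mul_left_cancel₀ h2 (by linear_combination e4 - e3)
    have hd : d = d' := mul_left_cancel₀ h2 (by linear_combination e3 + e4)
    rw [ha, hb, hc, hd]

theorem card_productCongruence_le {F : K[X]} (hF : Irreducible F) {m : ℕ} (hm0 : 0 < m)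
    (hm : m ≤ F.natDegree) :
    (productCongruence F (interval 0 m) (interval 0 m)).card ≤
      4 * (Nat.card K ^ m * Nat.card K ^ m) + maxDivisors K F.natDegree *
        (Nat.card K ^ m * Nat.card K ^ m * Nat.card K ^ (2 * m - F.natDegree)) := by
  classical
  set I : Finset K[X] := interval 0 m with hI
  rw [← Finset.card_filter_add_card_filter_not (fun x => F ∣ x.1 * x.2.1)]
  refine add_le_add ?_ ?_
  -- When `F` divides `ab` it also divides `cd`; since `m ≤ deg F`, each pair then has a zero entry.
  · set Z : Finset (K[X] × K[X]) := {0} ×ˢ I ∪ I ×ˢ {0} with hZ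
    have hZc : Z.card ≤ 2 * Nat.card K ^ m := by
      refine (Finset.card_union_le _ _).trans ?_
      simp [hI, card_interval, two_mul]
    have hmem : ∀ a ∈ I, ∀ b ∈ I, F ∣ a * b → (a, b) ∈ Z := by
      intro a ha b hb h
      rcases hF.prime.dvd_or_dvd h with h | h
      · simp [hZ, eq_zero_of_mem_interval_of_dvd hm ha h, hb]
      · simp [hZ, eq_zero_of_mem_interval_of_dvd hm hb h, ha]
    calc _ ≤ (Z ×ˢ Z).card := by
          refine Finset.card_le_card_of_injOn (fun x => ((x.1, x.2.1), (x.2.2.1, x.2.2.2))) ?_ ?_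
          · rintro ⟨a, b, c, d⟩ hx
            simp only [Finset.coe_filter, Set.mem_ofPred_eq, mem_productCongruence] at hx
            obtain ⟨⟨⟨ha, hb, hc, hd⟩, h1⟩, h2⟩ := hx
            exact Finset.mem_product.2 ⟨hmem a ha b hb h2,
              hmem c hc d hd ((dvd_sub_right h2).1 h1)⟩
          · rintro ⟨a, b, c, d⟩ - ⟨a', b', c', d'⟩ - h
            simpa [and_assoc] using h
      _ ≤ (2 * Nat.card K ^ m) * (2 * Nat.card K ^ m) := by
          rw [Finset.card_product]
          exact Nat.mul_le_mul hZc hZc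
      _ = 4 * (Nat.card K ^ m * Nat.card K ^ m) := by ring
  -- Otherwise `c`, `d` and the quotient `z` determine `ab = cd + Fz ≠ 0`, and `a` is one of its
  -- divisors.
  · have hcard : ((I ×ˢ I) ×ˢ interval (0 : K[X]) (2 * m - F.natDegree)).card =
        Nat.card K ^ m * Nat.card K ^ m * Nat.card K ^ (2 * m - F.natDegree) := by
      simp [hI, card_interval]
    rw [← hcard]
    refine Finset.card_le_mul_card_image_of_maps_to
      (f := fun x => ((x.2.2.1, x.2.2.2), (x.1 * x.2.1 - x.2.2.1 * x.2.2.2) / F)) ?_ _ ?_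
    · rintro ⟨a, b, c, d⟩ hx
      simp only [Finset.mem_filter, mem_productCongruence] at hx
      obtain ⟨⟨⟨ha, hb, hc, hd⟩, h1⟩, -⟩ := hx
      refine Finset.mem_product.2 ⟨Finset.mem_product.2 ⟨hc, hd⟩, ?_⟩
      apply mem_interval_of_natDegree_mul hF.ne_zero
      rw [EuclideanDomain.mul_div_cancel' hF.ne_zero h1]
      rw [hI, mem_interval_zero hm0] at ha hb hc hd
      have hdeg : (a * b - c * d).natDegree ≤ (m - 1) + (m - 1) :=
        natDegree_mul_sub_mul_le (by omega) (by omega) (by omega) (by omega)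
      show (a * b - c * d).natDegree < _
      omega
    · rintro ⟨⟨c, d⟩, z⟩ -
      rcases Finset.eq_empty_or_nonempty (((productCongruence F I I).filter
        fun x => ¬ F ∣ x.1 * x.2.1).filter fun x => ((x.2.2.1, x.2.2.2),
          (x.1 * x.2.1 - x.2.2.1 * x.2.2.2) / F) = ((c, d), z)) with h | ⟨x, hx⟩
      · rw [h]
        simp
      have key : ∀ x ∈ ((productCongruence F I I).filter
        fun x => ¬ F ∣ x.1 * x.2.1).filter fun x => ((x.2.2.1, x.2.2.2),
          (x.1 * x.2.1 - x.2.2.1 * x.2.2.2) / F) = ((c, d), z),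
          x.1 * x.2.1 = c * d + F * z ∧ x.1 ∈ I ∧ x.2.1 ∈ I ∧ x.2.2.1 = c ∧ x.2.2.2 = d ∧
            ¬ F ∣ x.1 * x.2.1 := by
        rintro ⟨a, b, c', d'⟩ hx
        simp only [Finset.mem_filter, mem_productCongruence, Prod.mk.injEq] at hx
        obtain ⟨⟨⟨⟨ha, hb, hc, hd⟩, h1⟩, h2⟩, ⟨rfl, rfl⟩, rfl⟩ := hx
        refine ⟨?_, ha, hb, rfl, rfl, h2⟩
        simp only
        rw [EuclideanDomain.mul_div_cancel' hF.ne_zero h1]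
        ring
      obtain ⟨h1, ha, hb, -, -, h2⟩ := key x hx
      have hN : c * d + F * z ≠ 0 := by
        rw [← h1]
        exact fun h => h2 (h ▸ dvd_zero F)
      refine card_le_maxDivisors_of_injOn hN ?_ _ (fun x => x.1) ?_ ?_
      · rw [← h1]
        rw [hI, mem_interval_zero hm0] at ha hb
        refine natDegree_mul_le.trans ?_
        omega
      · intro x hx y hy hxy
        obtain ⟨k1, -, -, k2, k3, k4⟩ := key x hx
        obtain ⟨l1, -, -, l2, l3, -⟩ := key y hy
        have hne : x.1 ≠ 0 := by
          intro h
          rw [h, zero_mul] at k4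
          exact k4 (dvd_zero F)
        have hxy' : x.1 = y.1 := hxy
        have h21 : x.2.1 = y.2.1 := mul_left_cancel₀ hne (by rw [k1, hxy', l1])
        exact Prod.ext hxy' (Prod.ext h21 (Prod.ext (k2.trans l2.symm) (k3.trans l3.symm)))
      · intro x hx
        rw [← (key x hx).1]
        exact dvd_mul_right _ _

/-- Dirichlet's pigeonhole: `q^(k+1) · q^(r-k)` pairs exceed the `q^r` residues. If `t` were 0, then
`u` would be a multiple of `F` of smaller degree, hence 0. -/
theorem exists_small_multiple {F : K[X]} (hF : F ≠ 0) (b : AdjoinRoot F) {k : ℕ}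
    (hk : k < F.natDegree) :
    ∃ t u : K[X], t ≠ 0 ∧ t.natDegree ≤ k ∧ u.natDegree < F.natDegree - k ∧
      AdjoinRoot.mk F t * b = AdjoinRoot.mk F u := by
  classical
  have := finite_adjoinRoot hF
  have := Fintype.ofFinite (AdjoinRoot F)
  have hcard : (Finset.univ : Finset (AdjoinRoot F)).card <
      (interval (0 : K[X]) (k + 1) ×ˢ interval (0 : K[X]) (F.natDegree - k)).card := by
    rw [Finset.card_univ, card_adjoinRoot hF, Finset.card_product, card_interval, card_interval,
      ← pow_add]
    exact Nat.pow_lt_pow_right Finite.one_lt_card (by omega)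
  obtain ⟨x, hx, y, hy, hne, heq⟩ := Finset.exists_ne_map_eq_of_card_lt_of_maps_to hcard
    (f := fun x => AdjoinRoot.mk F x.1 * b - AdjoinRoot.mk F x.2) (fun _ _ => by simp)
  rw [Finset.mem_product] at hx hy
  have ht := sub_mem_interval_zero hx.1 hy.1
  have hu := sub_mem_interval_zero hx.2 hy.2
  have hmk : AdjoinRoot.mk F (x.1 - y.1) * b = AdjoinRoot.mk F (x.2 - y.2) := by
    simp only [map_sub]
    linear_combination heq
  refine ⟨x.1 - y.1, x.2 - y.2, ?_, ?_, ?_, hmk⟩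
  · intro h0
    rw [h0, map_zero, zero_mul, eq_comm, AdjoinRoot.mk_eq_zero] at hmk
    exact hne (Prod.ext (sub_eq_zero.1 h0)
      (sub_eq_zero.1 (eq_zero_of_mem_interval_of_dvd (Nat.sub_le _ _) hu hmk)))
  · rw [mem_interval_zero (by omega)] at ht
    omega
  · rwa [mem_interval_zero (by omega)] at hu

/-- A bound for the number of points of a nondegenerate symmetric modular hyperbola in a box. -/
theorem card_hyperbola_le {F : K[X]} [hFI : Fact (Irreducible F)] {n : ℕ} (hn0 : 0 < n)
    (hn : n ≤ F.natDegree) (b c : AdjoinRoot F) (hc : c ≠ 0) (S : Finset (K[X] × K[X]))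
    (hS : ∀ x ∈ S, x.1 ∈ interval 0 n ∧ x.2 ∈ interval 0 n ∧
      (AdjoinRoot.mk F x.1 + b) * (AdjoinRoot.mk F x.2 + b) = c) :
    S.card ≤ maxDivisors K F.natDegree *
      Nat.card K ^ (n - (F.natDegree - n) / 2 - 1) := by
  classical
  have hF : F ≠ 0 := hFI.out.ne_zero
  set r := F.natDegree with hr
  -- This `k` balances the degrees of the two terms of `W` below, about `k + 2n` and `r - k + n`.
  set k := (r - n) / 2 with hk
  obtain ⟨t, u, ht0, htk, huk, htu⟩ := exists_small_multiple hF b (k := k) (by omega)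
  have htF : AdjoinRoot.mk F t ≠ 0 := by
    rw [Ne, AdjoinRoot.mk_eq_zero]
    intro h
    have := natDegree_le_of_dvd h ht0
    omega
  rcases S.eq_empty_or_nonempty with rfl | ⟨⟨a, a'⟩, ha⟩
  · simp
  obtain ⟨haI, haI', hac⟩ := hS _ ha
  rw [mem_interval_zero hn0] at haI haI'
  simp only at haI haI' hac
  -- Subtracting the fixed solution `(a, a')` eliminates `c`, and multiplying by `t` turns `b` into
  -- `u`: `F` divides `W`, whose low degree leaves few quotients.
  set W : K[X] × K[X] → K[X] := fun x =>
    t * (x.1 * x.2 - a * a') + u * (x.1 + x.2 - (a + a')) with hW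
  have hWF : ∀ x ∈ S, F ∣ W x := by
    intro x hx
    obtain ⟨-, -, h⟩ := hS x hx
    rw [← AdjoinRoot.mk_eq_zero]
    simp only [hW, map_add, map_sub, map_mul, ← htu]
    linear_combination AdjoinRoot.mk F t * (h - hac)
  rw [← card_interval (0 : K[X]) (n - k - 1)]
  refine Finset.card_le_mul_card_image_of_maps_to (f := fun x => W x / F) ?_ _ ?_
  · intro x hx
    obtain ⟨h1, h2, -⟩ := hS x hx
    rw [mem_interval_zero hn0] at h1 h2
    apply mem_interval_of_natDegree_mul hF
    rw [EuclideanDomain.mul_div_cancel' hF (hWF x hx)]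
    have hdeg : (W x).natDegree ≤ max (k + ((n - 1) + (n - 1))) ((r - k - 1) + (n - 1)) := by
      refine natDegree_add_le_of_le (natDegree_mul_le_of_le htk ?_)
        (natDegree_mul_le_of_le (by omega) ?_)
      · exact natDegree_mul_sub_mul_le (by omega) (by omega) (by omega) (by omega)
      · exact natDegree_add_sub_add_le (by omega) (by omega) (by omega) (by omega)
    omega
  · intro z _
    -- For a given quotient, multiplying by `t` and adding `u²` factors the equation; `c ≠ 0` keeps
    -- both factors nonzero. Two factors of degree at most `2r` explain the `4r` in `maxDivisors`.
    have key : ∀ x ∈ S.filter (fun x => W x / F = z),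
        (t * x.1 + u) * (t * x.2 + u) = t * (t * (a * a') + u * (a + a') + F * z) + u ^ 2 ∧
        t * x.1 + u ≠ 0 ∧ t * x.2 + u ≠ 0 ∧ (t * x.1 + u).natDegree ≤ 2 * r ∧
        (t * x.2 + u).natDegree ≤ 2 * r := by
      intro x hx
      rw [Finset.mem_filter] at hx
      obtain ⟨hx, rfl⟩ := hx
      obtain ⟨h1, h2, h3⟩ := hS x hx
      rw [mem_interval_zero hn0] at h1 h2
      have hne : ∀ y : K[X], AdjoinRoot.mk F y + b ≠ 0 → t * y + u ≠ 0 := by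
        intro y hy h
        have h' := congrArg (AdjoinRoot.mk F) h
        rw [map_add, map_mul, ← htu, ← mul_add, map_zero] at h'
        exact mul_ne_zero htF hy h'
      have hdeg : ∀ y : K[X], y.natDegree < n → (t * y + u).natDegree ≤ 2 * r := by
        intro y hy
        refine natDegree_add_le_of_degree_le (natDegree_mul_le.trans ?_) ?_ <;> omega
      refine ⟨?_, hne _ (left_ne_zero_of_mul (h3 ▸ hc)), hne _ (right_ne_zero_of_mul (h3 ▸ hc)),
        hdeg _ h1, hdeg _ h2⟩
      rw [EuclideanDomain.mul_div_cancel' hF (hWF x hx)]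
      simp only [hW]
      ring
    rcases (S.filter (fun x => W x / F = z)).eq_empty_or_nonempty with h | ⟨x, hx⟩
    · rw [h]
      simp
    obtain ⟨h1, h2, h3, h4, h5⟩ := key x hx
    refine card_le_maxDivisors_of_injOn (h1 ▸ mul_ne_zero h2 h3) ?_ _
      (fun x => t * x.1 + u) ?_ ?_
    · rw [← h1]
      refine natDegree_mul_le.trans ?_
      omega
    · intro x hx y hy hxy
      obtain ⟨k1, k2, -⟩ := key x hx
      obtain ⟨l1, -⟩ := key y hy
      have hxy' : t * x.1 + u = t * y.1 + u := hxy
      have e2 : t * x.2 + u = t * y.2 + u :=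
        mul_left_cancel₀ k2 (by rw [k1, hxy', l1])
      exact Prod.ext (mul_left_cancel₀ ht0 (add_right_cancel hxy'))
        (mul_left_cancel₀ ht0 (add_right_cancel e2))
    · intro x hx
      rw [← (key x hx).1]
      exact dvd_mul_right _ _

/-- If `1/x₃ + 1/x₄ = 0`, then `x₁` and `x₃` determine `x₂` and `x₄`. Otherwise, with `l = 1/x₃ +
1/x₄`, the equation reads `(x₁ - 1/l)(x₂ - 1/l) = 1/l²`, a hyperbola with nonzero constant. -/
theorem energyInv_le {F : K[X]} [hFI : Fact (Irreducible F)] {n : ℕ} (hn0 : 0 < n)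
    (hn : n ≤ F.natDegree) (t₀ : K[X]) :
    energyInv F (interval t₀ n) ≤ Nat.card K ^ n * Nat.card K ^ n +
      maxDivisors K F.natDegree * Nat.card K ^ (n - (F.natDegree - n) / 2 - 1) *
        (Nat.card K ^ n * Nat.card K ^ n) := by
  classical
  set I := interval t₀ n with hI
  have hcard : (I ×ˢ I).card = Nat.card K ^ n * Nat.card K ^ n := by
    simp [hI, card_interval]
  rw [energyInv, ← hcard, ← Finset.card_filter_add_card_filter_not
    (fun x => (AdjoinRoot.mk F x.2.2.1)⁻¹ + (AdjoinRoot.mk F x.2.2.2)⁻¹ = 0)]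
  set E := (I ×ˢ I ×ˢ I ×ˢ I).filter fun x =>
    (IsCoprime x.1 F ∧ IsCoprime x.2.1 F ∧ IsCoprime x.2.2.1 F ∧ IsCoprime x.2.2.2 F) ∧
    F ∣ (invMod F x.1 + invMod F x.2.1) - (invMod F x.2.2.1 + invMod F x.2.2.2) with hE
  have hmem : ∀ x ∈ E, (x.1 ∈ I ∧ x.2.1 ∈ I ∧ x.2.2.1 ∈ I ∧ x.2.2.2 ∈ I) ∧
      (AdjoinRoot.mk F x.1 ≠ 0 ∧ AdjoinRoot.mk F x.2.1 ≠ 0) ∧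
      (AdjoinRoot.mk F x.1)⁻¹ + (AdjoinRoot.mk F x.2.1)⁻¹ =
        (AdjoinRoot.mk F x.2.2.1)⁻¹ + (AdjoinRoot.mk F x.2.2.2)⁻¹ := by
    intro x hx
    simp only [hE, Finset.mem_filter, Finset.mem_product] at hx
    obtain ⟨h1, ⟨c1, c2, c3, c4⟩, h2⟩ := hx
    refine ⟨h1, ⟨(isCoprime_iff_mk_ne_zero hFI.out).1 c1,
      (isCoprime_iff_mk_ne_zero hFI.out).1 c2⟩, ?_⟩
    rwa [← AdjoinRoot.mk_eq_zero, map_sub, map_add, map_add, mk_invMod c1, mk_invMod c2,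
      mk_invMod c3, mk_invMod c4, sub_eq_zero] at h2
  refine add_le_add ?_ ?_
  · refine Finset.card_le_card_of_injOn (fun x => (x.1, x.2.2.1)) ?_ ?_
    · intro x hx
      have h := (hmem x (Finset.mem_filter.1 hx).1).1
      exact Finset.mem_product.2 ⟨h.1, h.2.2.1⟩
    · intro x hx y hy hxy
      obtain ⟨hx, hx0⟩ := Finset.mem_filter.1 hx
      obtain ⟨hy, hy0⟩ := Finset.mem_filter.1 hy
      obtain ⟨⟨a1, a2, a3, a4⟩, -, h1⟩ := hmem x hx
      obtain ⟨⟨b1, b2, b3, b4⟩, -, h2⟩ := hmem y hy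
      simp only [Prod.mk.injEq] at hxy
      obtain ⟨e1, e3⟩ := hxy
      rw [hx0, e1] at h1
      rw [hy0] at h2
      rw [e3] at hx0
      have e2 : x.2.1 = y.2.1 := mk_injOn_interval hn a2 b2
        (inv_injective (add_left_cancel (h1.trans h2.symm)))
      have e4 : x.2.2.2 = y.2.2.2 := mk_injOn_interval hn a4 b4
        (inv_injective (add_left_cancel (hx0.trans hy0.symm)))
      exact Prod.ext e1 (Prod.ext e2 (Prod.ext e3 e4))
  · refine Finset.card_le_mul_card_image_of_maps_to (f := fun x => (x.2.2.1, x.2.2.2)) ?_ _ ?_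
    · intro x hx
      have h := (hmem x (Finset.mem_filter.1 hx).1).1
      exact Finset.mem_product.2 ⟨h.2.2.1, h.2.2.2⟩
    · rintro ⟨c, d⟩ -
      set l := (AdjoinRoot.mk F c)⁻¹ + (AdjoinRoot.mk F d)⁻¹ with hl
      by_cases hl0 : l = 0
      · rw [Finset.card_eq_zero.2]
        · exact Nat.zero_le _
        · rw [Finset.filter_eq_empty_iff]
          rintro x hx he
          simp only [Prod.mk.injEq] at he
          apply (Finset.mem_filter.1 hx).2
          rw [he.1, he.2, ← hl, hl0]
      · have hinj : Set.InjOn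
            (fun x : K[X] × K[X] × K[X] × K[X] => (x.1 - t₀, x.2.1 - t₀))
            ((E.filter fun x => ¬ (AdjoinRoot.mk F x.2.2.1)⁻¹ +
              (AdjoinRoot.mk F x.2.2.2)⁻¹ = 0).filter fun x => (x.2.2.1, x.2.2.2) = (c, d)) := by
          intro x hx y hy hxy
          have ex := (Finset.mem_filter.1 hx).2
          have ey := (Finset.mem_filter.1 hy).2
          simp only [Prod.mk.injEq, sub_left_inj] at hxy ex ey
          exact Prod.ext hxy.1 (Prod.ext hxy.2
            (Prod.ext (ex.1.trans ey.1.symm) (ex.2.trans ey.2.symm)))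
        rw [← Finset.card_image_of_injOn hinj]
        refine card_hyperbola_le hn0 hn (AdjoinRoot.mk F t₀ - l⁻¹) ((l⁻¹) ^ 2)
          (pow_ne_zero _ (inv_ne_zero hl0)) _ ?_
        intro y hy
        obtain ⟨x, hx, rfl⟩ := Finset.mem_image.1 hy
        obtain ⟨hx, he⟩ := Finset.mem_filter.1 hx
        obtain ⟨⟨a1, a2, -, -⟩, ⟨n1, n2⟩, h1⟩ := hmem x (Finset.mem_filter.1 hx).1
        simp only [Prod.mk.injEq] at he
        rw [he.1, he.2, ← hl] at h1
        refine ⟨?_, ?_, ?_⟩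
        · rw [mem_interval] at a1 ⊢
          rwa [sub_zero]
        · rw [mem_interval] at a2 ⊢
          rwa [sub_zero]
        · simp only [map_sub]
          have hs : AdjoinRoot.mk F x.1 + AdjoinRoot.mk F x.2.1 =
              l * (AdjoinRoot.mk F x.1 * AdjoinRoot.mk F x.2.1) := by
            rw [← h1]
            field_simp
            ring
          linear_combination -l⁻¹ * hs -
            AdjoinRoot.mk F x.1 * AdjoinRoot.mk F x.2.1 * inv_mul_cancel₀ hl0

end Energies

/-! ### From the field estimates to the stated inequalities. -/

section Assembly

variable {K : Type*} [Field K]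

theorem two_ne_zero_of_odd_card [Fintype K] (hq : Odd (Fintype.card K)) : (2 : K) ≠ 0 := by
  apply Ring.two_ne_zero
  rw [Ne, FiniteField.even_card_iff_char_two]
  rw [Nat.odd_iff] at hq
  omega

/-- Moving terms across turns equal differences into equal sums, and the common factor `c` cancels.
-/
theorem diffEnergy_inv_le {F : K[X]} [hFI : Fact (Irreducible F)] (S T : Finset K[X])
    (hST : S ⊆ T) (hS : ∀ t ∈ S, AdjoinRoot.mk F t ≠ 0) {c : AdjoinRoot F} (hc : c ≠ 0) :
    diffEnergy S (fun t => c * (AdjoinRoot.mk F t)⁻¹) ≤ energyInv F T := by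
  classical
  rw [diffEnergy, coincidences, energyInv]
  refine Finset.card_le_card_of_injOn (fun x => (x.1.1, x.2.2, x.2.1, x.1.2)) ?_ ?_
  · rintro ⟨⟨x, y⟩, z, w⟩ hx
    simp only [Finset.coe_filter, Set.mem_ofPred_eq, Finset.mem_product] at hx ⊢
    obtain ⟨⟨⟨hx, hy⟩, hz, hw⟩, h⟩ := hx
    have hcop : ∀ t ∈ S, IsCoprime t F := fun t ht =>
      (isCoprime_iff_mk_ne_zero hFI.out).2 (hS t ht)
    refine ⟨⟨hST hx, hST hw, hST hz, hST hy⟩, ⟨hcop x hx, hcop w hw, hcop z hz, hcop y hy⟩, ?_⟩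
    rw [← AdjoinRoot.mk_eq_zero]
    simp only [map_sub, map_add, mk_invMod (hcop x hx), mk_invMod (hcop y hy),
      mk_invMod (hcop z hz), mk_invMod (hcop w hw)]
    apply mul_left_cancel₀ hc
    linear_combination h
  · rintro ⟨⟨a, b⟩, c, d⟩ - ⟨⟨a', b'⟩, c', d'⟩ - h
    simp only [Prod.mk.injEq] at h ⊢
    tauto

theorem norm_le_weightSup {S : Finset K[X]} {β : K[X] → ℂ} {t : K[X]} (ht : t ∈ S) :
    ‖β t‖ ≤ weightSup S β := by
  rw [weightSup, ← coe_nnnorm, NNReal.coe_le_coe]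
  exact Finset.le_sup (f := fun s => ‖β s‖₊) ht

theorem weightNorm_two_pow_eight (S : Finset K[X]) (α : K[X] → ℂ) :
    weightNorm 2 S α ^ 8 = (∑ s ∈ S, ‖α s‖ ^ 2) ^ 4 := by
  have h : 0 ≤ ∑ s ∈ S, ‖α s‖ ^ 2 := Finset.sum_nonneg fun _ _ => by positivity
  simp only [weightNorm, Real.rpow_two]
  rw [← Real.rpow_natCast (_ ^ _), ← Real.rpow_mul h, ← Real.rpow_natCast (∑ s ∈ S, _)]
  norm_num

theorem diffEnergy_sq_le (F : K[X]) [Fact (Irreducible F)] (S : Finset K[X]) :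
    diffEnergy S (fun s => AdjoinRoot.mk F s ^ 2) ≤ energySq F S := by
  classical
  rw [diffEnergy, coincidences, energySq]
  refine Finset.card_le_card_of_injOn (fun x => (x.1.1, x.2.2, x.2.1, x.1.2)) ?_ ?_
  · rintro ⟨⟨a, b⟩, c, d⟩ hx
    simp only [Finset.coe_filter, Set.mem_ofPred_eq, Finset.mem_product] at hx ⊢
    obtain ⟨⟨⟨ha, hb⟩, hc, hd⟩, h⟩ := hx
    refine ⟨⟨ha, hd, hc, hb⟩, ?_⟩
    rw [← AdjoinRoot.mk_eq_zero]
    simp only [map_sub, map_add, map_pow]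
    linear_combination h
  · rintro ⟨⟨a, b⟩, c, d⟩ - ⟨⟨a', b'⟩, c', d'⟩ - h
    simp only [Prod.mk.injEq] at h ⊢
    tauto

variable [Finite K]

theorem gaussSumF_eq {F : K[X]} (hF : F ≠ 0) [Fintype (AdjoinRoot F)] (s t : K[X]) :
    gaussSumF F s t =
      ∑ z, quotChar hF (AdjoinRoot.mk F s * z + AdjoinRoot.mk F t * z ^ 2) := by
  rw [← sum_interval_eq_sum_adjoinRoot hF]
  refine Finset.sum_congr rfl fun x _ => ?_
  rw [← quotChar_mk hF]
  simp only [map_add, map_mul, map_pow]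

theorem gaussForm_pow_eight_le {F a : K[X]} [hFI : Fact (Irreducible F)]
    (h2 : (2 : AdjoinRoot F) ≠ 0) (ha : IsCoprime a F) (S T : Finset K[X]) (α β : K[X] → ℂ) :
    ‖gaussForm F a α β S T‖ ^ 8 ≤ weightNorm 2 S α ^ 8 * weightSup T β ^ 8 * (T.card : ℝ) ^ 4 *
      ((Nat.card K : ℝ) ^ F.natDegree) ^ 5 * energySq F S * energyInv F T := by
  classical
  have hF : F ≠ 0 := hFI.out.ne_zero
  have := finite_adjoinRoot hF
  have := Fintype.ofFinite (AdjoinRoot F)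
  set ψ := quotChar hF with hψdef
  have hψ : ψ.IsPrimitive := quotChar_isPrimitive
  set T' := T.filter fun t => ¬ F ∣ t with hT'
  have hT'0 : ∀ t ∈ T', AdjoinRoot.mk F t ≠ 0 := fun t ht => by
    rw [Ne, AdjoinRoot.mk_eq_zero]
    exact (Finset.mem_filter.1 ht).2
  have ha0 : AdjoinRoot.mk F a ≠ 0 := (isCoprime_iff_mk_ne_zero hFI.out).1 ha
  have h4 : (4 : AdjoinRoot F) ≠ 0 := by
    rw [show (4 : AdjoinRoot F) = 2 * 2 by norm_num]
    exact mul_ne_zero h2 h2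
  set c : AdjoinRoot F := -(4 * AdjoinRoot.mk F a)⁻¹ with hc
  have hc0 : c ≠ 0 := neg_ne_zero.2 (inv_ne_zero (mul_ne_zero h4 ha0))
  -- The pure quadratic sum depends on `t` alone, so it joins the weight `β t` at the cost of `√Q`.
  set g : K[X] → ℂ := fun t => ∑ x, ψ (AdjoinRoot.mk F (a * t) * x ^ 2) with hg
  have hat : ∀ t ∈ T', AdjoinRoot.mk F (a * t) ≠ 0 := fun t ht => by
    rw [map_mul]
    exact mul_ne_zero ha0 (hT'0 t ht)
  have hform : gaussForm F a α β S T = ∑ s ∈ S, ∑ t ∈ T', α s * (β t * g t) *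
      ψ (AdjoinRoot.mk F s ^ 2 * (c * (AdjoinRoot.mk F t)⁻¹)) := by
    rw [gaussForm]
    refine Finset.sum_congr rfl fun s _ => Finset.sum_congr (by rw [hT']) fun t ht => ?_
    rw [gaussSumF_eq hF, gauss_sum_complete_square h2 (hat t ht)]
    have he : -(4 * AdjoinRoot.mk F (a * t))⁻¹ = c * (AdjoinRoot.mk F t)⁻¹ := by
      rw [hc, map_mul, ← mul_assoc, mul_inv (4 * AdjoinRoot.mk F a), neg_mul]
    rw [he]
    ring
  have hL : (Fintype.card (AdjoinRoot F) : ℝ) = (Nat.card K : ℝ) ^ F.natDegree := by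
    rw [card_adjoinRoot hF, Nat.cast_pow]
  set Q := (Nat.card K : ℝ) ^ F.natDegree with hQ
  have hQ0 : 0 ≤ Q := by positivity
  have hβ0 : 0 ≤ weightSup T β := NNReal.coe_nonneg _
  have hγ : ∀ t ∈ T', ‖β t * g t‖ ≤ weightSup T β * √Q := by
    intro t ht
    rw [norm_mul]
    gcongr
    · exact norm_le_weightSup (Finset.mem_filter.1 ht).1
    · apply Real.le_sqrt_of_sq_le
      rw [normSq_gauss_sum hψ h2 (hat t ht), hL]
  have hmain := norm_weighted_bilinear_le hψ S T' (fun s => AdjoinRoot.mk F s ^ 2)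
    (fun t => c * (AdjoinRoot.mk F t)⁻¹) α (fun t => β t * g t)
    (mul_nonneg hβ0 (Real.sqrt_nonneg Q)) hγ
  rw [← hform, ← weightNorm_two_pow_eight, hL] at hmain
  have e1 : (diffEnergy S (fun s => AdjoinRoot.mk F s ^ 2) : ℝ) ≤ energySq F S := by
    exact_mod_cast diffEnergy_sq_le F S
  have e2 : (diffEnergy T' (fun t => c * (AdjoinRoot.mk F t)⁻¹) : ℝ) ≤ energyInv F T := by
    exact_mod_cast diffEnergy_inv_le T' T (Finset.filter_subset _ _) hT'0 hc0
  have e3 : (T'.card : ℝ) ≤ T.card := by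
    exact_mod_cast Finset.card_le_card (Finset.filter_subset _ _)
  -- These four powers of `Q` and the one from the bilinear bound make `Q^5`, whence the exponent
  -- `5r/8`.
  have e4 : (weightSup T β * √Q) ^ 8 = weightSup T β ^ 8 * Q ^ 4 := by
    rw [mul_pow, show √Q ^ 8 = (√Q ^ 2) ^ 4 by ring, Real.sq_sqrt hQ0]
  rw [e4] at hmain
  have h0 : 0 ≤ weightNorm 2 S α ^ 8 := by
    rw [weightNorm_two_pow_eight]
    exact pow_nonneg (Finset.sum_nonneg fun _ _ => by positivity) _
  calc ‖gaussForm F a α β S T‖ ^ 8 ≤ _ := hmain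
    _ ≤ weightNorm 2 S α ^ 8 * (weightSup T β ^ 8 * Q ^ 4) * (T.card : ℝ) ^ 4 *
          (Q * energySq F S * energyInv F T) := by gcongr
    _ = _ := by ring

theorem rpow_eighth_le {E c A B : ℝ} (hE : 0 ≤ E) (hc : 1 ≤ c) (hA : 0 ≤ A) (hB : 0 ≤ B)
    (h : E ≤ c * (A + B)) :
    E ^ (1 / 8 : ℝ) ≤ c * (A ^ (1 / 8 : ℝ) + B ^ (1 / 8 : ℝ)) := by
  calc E ^ (1 / 8 : ℝ) ≤ (c * (A + B)) ^ (1 / 8 : ℝ) := by gcongr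
    _ = c ^ (1 / 8 : ℝ) * (A + B) ^ (1 / 8 : ℝ) :=
        Real.mul_rpow (by linarith) (by linarith)
    _ ≤ c * (A ^ (1 / 8 : ℝ) + B ^ (1 / 8 : ℝ)) := by
        gcongr
        · exact (Real.rpow_le_rpow_of_exponent_le hc (by norm_num)).trans_eq (Real.rpow_one c)
        · exact Real.rpow_add_le_add_rpow hA hB (by norm_num) (by norm_num)

/-- The added 1 covers truncated subtraction: `h` may be 0 while the real exponent `x` is negative.
-/
theorem pow_le_rpow_add_one {q : ℝ} (hq : 1 ≤ q) {h : ℕ} {x : ℝ} (hx : h = 0 ∨ (h : ℝ) ≤ x) :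
    q ^ h ≤ q ^ x + 1 := by
  rcases hx with rfl | hx
  · rw [pow_zero]
    linarith [Real.rpow_nonneg (zero_le_one.trans hq) x]
  · rw [← Real.rpow_natCast]
    linarith [Real.rpow_le_rpow_of_exponent_le hq hx]

theorem energyInv_rpow_le {F : K[X]} (hF : Irreducible F) {n : ℕ} (hn0 : 0 < n)
    (hn : n ≤ F.natDegree) (t₀ : K[X]) :
    (energyInv F (interval t₀ n) : ℝ) ^ (1 / 8 : ℝ) ≤ 5 * maxDivisors K F.natDegree *
      ((Nat.card K : ℝ) ^ (7 * (n : ℝ) / 16 - (F.natDegree : ℝ) / 16) +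
        (Nat.card K : ℝ) ^ ((n : ℝ) / 4)) := by
  have : Fact (Irreducible F) := ⟨hF⟩
  have h : (energyInv F (interval t₀ n) : ℝ) ≤ _ := Nat.cast_le.2 (energyInv_le hn0 hn t₀)
  set q : ℝ := (Nat.card K : ℝ) with hq
  set r := F.natDegree with hr
  have hq1 : 1 ≤ q := by
    rw [hq]
    exact_mod_cast Finite.one_lt_card.le
  have hq0 : 0 < q := by linarith
  have hM : (1 : ℝ) ≤ maxDivisors K r := by exact_mod_cast one_le_maxDivisors r
  push_cast at h
  rw [← hq] at h
  have hz : q ^ (n - (r - n) / 2 - 1) ≤ q ^ ((3 * (n : ℝ) - r) / 2) + 1 := by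
    apply pow_le_rpow_add_one hq1
    by_cases h0 : n - (r - n) / 2 - 1 = 0
    · exact Or.inl h0
    · right
      rw [le_div_iff₀ (by norm_num), le_sub_iff_add_le]
      -- The `- 1` absorbs the loss from rounding `(r - n) / 2` down.
      have : (n - (r - n) / 2 - 1) * 2 + r ≤ 3 * n := by omega
      exact_mod_cast this
  have hnn : q ^ n * q ^ n = q ^ (2 * (n : ℝ)) := by
    rw [← pow_add, ← Real.rpow_natCast]
    push_cast
    ring_nf
  rw [hnn] at h
  have hprod : q ^ ((3 * (n : ℝ) - r) / 2) * q ^ (2 * (n : ℝ)) =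
      q ^ (7 * (n : ℝ) / 2 - r / 2) := by
    rw [← Real.rpow_add hq0]
    ring_nf
  have hA := Real.rpow_nonneg hq0.le (7 * (n : ℝ) / 2 - r / 2)
  have hB := Real.rpow_nonneg hq0.le (2 * (n : ℝ))
  have hfin : (energyInv F (interval t₀ n) : ℝ) ≤ 5 * maxDivisors K r *
      (q ^ (7 * (n : ℝ) / 2 - r / 2) + q ^ (2 * (n : ℝ))) := by
    calc _ ≤ _ := h
      _ ≤ q ^ (2 * (n : ℝ)) + maxDivisors K r * (q ^ ((3 * (n : ℝ) - r) / 2) + 1) *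
            q ^ (2 * (n : ℝ)) := by gcongr
      _ = q ^ (2 * (n : ℝ)) + maxDivisors K r *
            (q ^ (7 * (n : ℝ) / 2 - r / 2) + q ^ (2 * (n : ℝ))) := by rw [← hprod]; ring
      _ ≤ _ := by nlinarith
  have hres := rpow_eighth_le (Nat.cast_nonneg _) (by linarith) hA hB hfin
  rw [← Real.rpow_mul hq0.le, ← Real.rpow_mul hq0.le] at hres
  convert hres using 4 <;> ring

theorem energySq_rpow_le {F : K[X]} (h2 : (2 : K[X]) ≠ 0) (hF : Irreducible F) {m : ℕ}
    (hm0 : 0 < m) (hm : m ≤ F.natDegree) (s₀ : K[X]) :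
    (energySq F (interval s₀ m) : ℝ) ^ (1 / 8 : ℝ) ≤ 5 * maxDivisors K F.natDegree *
      ((Nat.card K : ℝ) ^ ((m : ℝ) / 2 - (F.natDegree : ℝ) / 8) +
        (Nat.card K : ℝ) ^ ((m : ℝ) / 4)) := by
  have h : (energySq F (interval s₀ m) : ℝ) ≤ _ := Nat.cast_le.2
    ((energySq_le_productCongruence h2 F s₀ m).trans (card_productCongruence_le hF hm0 hm))
  set q : ℝ := (Nat.card K : ℝ) with hq
  set r := F.natDegree with hr
  have hq1 : 1 ≤ q := by
    rw [hq]
    exact_mod_cast Finite.one_lt_card.le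
  have hq0 : 0 < q := by linarith
  have hM : (1 : ℝ) ≤ maxDivisors K r := by exact_mod_cast one_le_maxDivisors r
  push_cast at h
  rw [← hq] at h
  have hz : q ^ (2 * m - r) ≤ q ^ (2 * (m : ℝ) - r) + 1 := by
    apply pow_le_rpow_add_one hq1
    by_cases h0 : 2 * m - r = 0
    · exact Or.inl h0
    · right
      rw [le_sub_iff_add_le]
      have : (2 * m - r) + r ≤ 2 * m := by omega
      exact_mod_cast this
  have hmm : q ^ m * q ^ m = q ^ (2 * (m : ℝ)) := by
    rw [← pow_add, ← Real.rpow_natCast]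
    push_cast
    ring_nf
  rw [hmm] at h
  have hprod : q ^ (2 * (m : ℝ)) * q ^ (2 * (m : ℝ) - r) = q ^ (4 * (m : ℝ) - r) := by
    rw [← Real.rpow_add hq0]
    ring_nf
  have hA := Real.rpow_nonneg hq0.le (4 * (m : ℝ) - r)
  have hB := Real.rpow_nonneg hq0.le (2 * (m : ℝ))
  have hfin : (energySq F (interval s₀ m) : ℝ) ≤ 5 * maxDivisors K r *
      (q ^ (4 * (m : ℝ) - r) + q ^ (2 * (m : ℝ))) := by
    calc _ ≤ _ := h
      _ ≤ 4 * q ^ (2 * (m : ℝ)) + maxDivisors K r * (q ^ (2 * (m : ℝ)) *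
            (q ^ (2 * (m : ℝ) - r) + 1)) := by gcongr
      _ = 4 * q ^ (2 * (m : ℝ)) + maxDivisors K r *
            (q ^ (4 * (m : ℝ) - r) + q ^ (2 * (m : ℝ))) := by rw [← hprod]; ring
      _ ≤ _ := by nlinarith
  have hres := rpow_eighth_le (Nat.cast_nonneg _) (by linarith) hA hB hfin
  rw [← Real.rpow_mul hq0.le, ← Real.rpow_mul hq0.le] at hres
  convert hres using 4 <;> ring

end Assembly

end FFGauss

theorem theorem3p6 {K : Type*} [Field K] [Fintype K] (hq : Odd (Fintype.card K)) :
    (∀ F a : K[X], Irreducible F → IsCoprime a F →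
      ∀ m n : ℕ, 0 < m → m ≤ F.natDegree → 0 < n → n ≤ F.natDegree →
      ∀ (s₀ t₀ : K[X]) (α β : K[X] → ℂ),
        ‖FFGauss.gaussForm F a α β (FFGauss.interval s₀ m) (FFGauss.interval t₀ n)‖ ≤
          FFGauss.weightNorm 2 (FFGauss.interval s₀ m) α *
          FFGauss.weightSup (FFGauss.interval t₀ n) β *
          (Fintype.card K : ℝ) ^ (5 * (F.natDegree : ℝ) / 8 + (n : ℝ) / 2) *
          (FFGauss.energyInv F (FFGauss.interval t₀ n) : ℝ) ^ (1 / 8 : ℝ) *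
          (FFGauss.energySq F (FFGauss.interval s₀ m) : ℝ) ^ (1 / 8 : ℝ)) ∧
    ∃ δ : ℕ → ℝ, δ =o[atTop] (fun r : ℕ => (r : ℝ)) ∧
      ∀ F : K[X], Irreducible F →
        (∀ n : ℕ, 0 < n → n ≤ F.natDegree → ∀ t₀ : K[X],
          (FFGauss.energyInv F (FFGauss.interval t₀ n) : ℝ) ^ (1 / 8 : ℝ) ≤
            (Fintype.card K : ℝ) ^ δ F.natDegree *
            ((Fintype.card K : ℝ) ^ (7 * (n : ℝ) / 16 - (F.natDegree : ℝ) / 16) +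
              (Fintype.card K : ℝ) ^ ((n : ℝ) / 4))) ∧
        (∀ m : ℕ, 0 < m → m ≤ F.natDegree → ∀ s₀ : K[X],
          (FFGauss.energySq F (FFGauss.interval s₀ m) : ℝ) ^ (1 / 8 : ℝ) ≤
            (Fintype.card K : ℝ) ^ δ F.natDegree *
            ((Fintype.card K : ℝ) ^ ((m : ℝ) / 2 - (F.natDegree : ℝ) / 8) +
              (Fintype.card K : ℝ) ^ ((m : ℝ) / 4))) := by
  have h2 : (2 : K) ≠ 0 := FFGauss.two_ne_zero_of_odd_card hq
  have hq1 : (1 : ℝ) < Fintype.card K := by exact_mod_cast Fintype.one_lt_card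
  have hq0 : (0 : ℝ) < Fintype.card K := by linarith
  -- Chosen so that `q^δ(r)` equals `5 * maxDivisors K r`, the constant in both energy bounds.
  refine ⟨?_, fun r => Real.logb (Fintype.card K) (5 * FFGauss.maxDivisors K r), ?_, ?_⟩
  · intro F a hF ha m n _ _ _ _ s₀ t₀ α β
    have : Fact (Irreducible F) := ⟨hF⟩
    have h2L : (2 : AdjoinRoot F) ≠ 0 := by
      have h := (map_ne_zero (algebraMap K (AdjoinRoot F))).2 h2
      rwa [map_ofNat] at h
    have h := FFGauss.gaussForm_pow_eight_le h2L ha (FFGauss.interval s₀ m)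
      (FFGauss.interval t₀ n) α β
    rw [FFGauss.card_interval, Nat.card_eq_fintype_card] at h
    have hβ : 0 ≤ FFGauss.weightSup (FFGauss.interval t₀ n) β := NNReal.coe_nonneg _
    have hα : 0 ≤ FFGauss.weightNorm 2 (FFGauss.interval s₀ m) α :=
      Real.rpow_nonneg (Finset.sum_nonneg fun _ _ => by positivity) _
    refine le_of_pow_le_pow_left₀ (n := 8) (by norm_num) (by positivity) (h.trans_eq ?_)
    have hroot : ∀ N : ℕ, ((N : ℝ) ^ (1 / 8 : ℝ)) ^ 8 = N := fun N => by
      rw [← Real.rpow_natCast, ← Real.rpow_mul (Nat.cast_nonneg N)]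
      norm_num
    have hpow : ((Fintype.card K : ℝ) ^ (5 * (F.natDegree : ℝ) / 8 + (n : ℝ) / 2)) ^ 8 =
        ((Fintype.card K : ℝ) ^ n) ^ 4 * ((Fintype.card K : ℝ) ^ F.natDegree) ^ 5 := by
      rw [← pow_mul, ← pow_mul, ← pow_add, ← Real.rpow_natCast, ← Real.rpow_natCast,
        ← Real.rpow_mul hq0.le]
      congr 1
      push_cast
      ring
    simp only [mul_pow, hroot, hpow]
    push_cast
    ring
  · simp only [Real.logb, div_eq_inv_mul]
    exact (FFGauss.isLittleO_log_maxDivisors (by norm_num)).const_mul_left _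
  · intro F hF
    have hM : (1 : ℝ) ≤ FFGauss.maxDivisors K F.natDegree := by
      exact_mod_cast FFGauss.one_le_maxDivisors F.natDegree
    have h2X : (2 : K[X]) ≠ 0 := by
      have h := C_ne_zero.2 h2
      rwa [map_ofNat] at h
    simp only [Real.rpow_logb hq0 hq1.ne' (show
      (0 : ℝ) < 5 * FFGauss.maxDivisors K F.natDegree by linarith)]
    simp only [← Nat.card_eq_fintype_card]
    exact ⟨fun n hn0 hn t₀ => FFGauss.energyInv_rpow_le hF hn0 hn t₀,
      fun m hm0 hm s₀ => FFGauss.energySq_rpow_le h2X hF hm0 hm s₀⟩
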